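/- Let $d\ge 2$, let $\ell\in\mathbb{R}^d$ with $|\ell|_1=1$, and let $\kappa\in(0,1/(2d)]$. Let $\Omega$ be the set of all families $\omega=(\omega(x,e,i))_{x\in\mathbb{Z}^d,\,e\in\mathbb{Z}^d,\,|e|=1,\,i\ge 1}$ with values in $[\kappa,1-\kappa]$ such that, for all $x\in\mathbb{Z}^d$ and $i\ge 1$, $$\sum_{|e|=1}\omega(x,e,i)=1\qquad\text{and}\qquad \sum_{|e|=1}\omega(x,e,i)\,e\cdot\ell\ge 0 .$$ For $\omega\in\Omega$, an excited random walk in the environment $\omega$ started at $0$ is a $\mathbb{Z}^d$-valued process $(X_n)_{n\ge 0}$ on a probability space with probability measure $P_{0,\omega}$ such that, $P_{0,\omega}$-almost surely, $X_0=0$ and, for all $n\ge 0$ and all unit vectors $e$, $$P_{0,\omega}[X_{n+1}=X_n+e\mid X_0,\dots,X_n]=\omega\bigl(X_n,e,\#\{m\le n\mid X_m=X_n\}\bigr).$$ Let $\mathbb{P}$ be a probability measure on $\Omega$ under which the family $(\omega(x,\cdot,\cdot))_{x\in\mathbb{Z}^d}$ is i.i.d., and suppose that $\mathbb{E}[\delta^0]>0$,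 where $\mathbb{E}$ is the expectation with respect to $\mathbb{P}$ and $$\delta^0(\omega)=\sum_{i\ge 1}\sum_{|e|=1}\omega(0,e,i)\,e\cdot\ell\in[0,\infty]$$ is the total drift in direction $\ell$ of all the cookies at the origin. Then for $\mathbb{P}$-almost all $\omega$ the walk is transient in direction $\ell$, i.e. $P_{0,\omega}$-almost surely $X_n\cdot\ell\to\infty$ as $n\to\infty$. -/

import Mathlib

open MeasureTheory ProbabilityTheory

namespace ExcitedWalk

/-- The sites of the lattice `ℤ^d`. -/
abbrev Site (d : ℕ) : Type := Fin d → ℤ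

/-- The `2d` unit vectors `e` of `ℤ^d`: a coordinate axis together with a sign. -/
abbrev Dir (d : ℕ) : Type := Fin d × ℤˣ

/-- The unit vector `± e_j` as an element of `ℤ^d`. -/
def Dir.vec {d : ℕ} (e : Dir d) : Site d := Pi.single e.1 (e.2 : ℤ)

/-- The inner product `x · ℓ` of a site `x ∈ ℤ^d` and a vector `ℓ ∈ ℝ^d`. -/
noncomputable def proj {d : ℕ} (ℓ : Fin d → ℝ) (x : Site d) : ℝ := ∑ j, (x j : ℝ) * ℓ j

/-- The drift `∑_e c(e) e · ℓ` in direction `ℓ` of a single cookie `c`. -/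
noncomputable def cookieDrift {d : ℕ} (ℓ : Fin d → ℝ) (c : Dir d → ℝ) : ℝ :=
  ∑ e, c e * proj ℓ e.vec

/-- The admissible sequences of cookies at one site. Cookies are numbered from `0`, so that
`s i e` is the probability to jump in direction `e` upon the `(i + 1)`-st visit. -/
def CookieStack (d : ℕ) (κ : ℝ) (ℓ : Fin d → ℝ) : Set (ℕ → Dir d → ℝ) :=
  {s | (∀ i e, s i e ∈ Set.Icc κ (1 - κ)) ∧ (∀ i, ∑ e, s i e = 1) ∧
    ∀ i, 0 ≤ cookieDrift ℓ (s i)}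

/-- Cookie environments: an admissible sequence of cookies at each site, with the product
`σ`-algebra. -/
abbrev Env (d : ℕ) (κ : ℝ) (ℓ : Fin d → ℝ) : Type := Site d → CookieStack d κ ℓ

/-- `prob ω x i e` is the probability, in the environment `ω`, to jump from `x` to `x + e` upon
the `(i + 1)`-st visit to `x`. -/
def prob {d : ℕ} {κ : ℝ} {ℓ : Fin d → ℝ} (ω : Env d κ ℓ) (x : Site d) (i : ℕ) (e : Dir d) : ℝ :=
  (ω x : ℕ → Dir d → ℝ) i e

/-- The total drift `δ^x(ω) ∈ [0, ∞]` in direction `ℓ` of all the cookies at the site `x`. -/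
noncomputable def totalDrift {d : ℕ} {κ : ℝ} {ℓ : Fin d → ℝ} (ω : Env d κ ℓ) (x : Site d) :
    ENNReal :=
  ∑' i, ENNReal.ofReal (cookieDrift ℓ (prob ω x i))

/-- The cookie sequences at the different sites are independent and identically distributed. -/
def IsIID {d : ℕ} {κ : ℝ} {ℓ : Fin d → ℝ} (μ : Measure (Env d κ ℓ)) : Prop :=
  iIndepFun (fun (x : Site d) (ω : Env d κ ℓ) => ω x) μ ∧
    ∀ x : Site d, IdentDistrib (fun ω : Env d κ ℓ => ω x) (fun ω : Env d κ ℓ => ω 0) μ μ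

/-- The number `#{m < n | p m = p n}` of visits of the path `p` to its time-`n` position strictly
before time `n`. -/
def priorVisits {d : ℕ} (p : ℕ → Site d) (n : ℕ) : ℕ :=
  ((Finset.range n).filter (fun m => p m = p n)).card

/-- The `σ`-algebra generated by the history `(X_0, …, X_n)`. -/
abbrev history {d : ℕ} {Ω' : Type*} (X : ℕ → Ω' → Site d) (n : ℕ) : MeasurableSpace Ω' :=
  MeasurableSpace.comap (fun w (m : Finset.Iic n) => X m w) inferInstance

/-- `X` is, under `P`, an excited random walk started at `x` in the environment `ω`. -/
structure IsERW {d : ℕ} {κ : ℝ} {ℓ : Fin d → ℝ} {Ω' : Type*} [MeasurableSpace Ω']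
    (ω : Env d κ ℓ) (x : Site d) (P : Measure Ω') (X : ℕ → Ω' → Site d) : Prop where
  measurable : ∀ n, Measurable (X n)
  start : ∀ᵐ w ∂P, X 0 w = x
  step : ∀ (n : ℕ) (e : Dir d),
    P⟦{w | X (n + 1) w = X n w + e.vec} | history X n⟧
      =ᵐ[P] fun w => prob ω (X n w) (priorVisits (fun m => X m w) n) e

/-- One step of the walk: the law of the position at time `n + 1` given the positions up to
time `n`. -/
noncomputable def stepKernel {d : ℕ} {κ : ℝ} {ℓ : Fin d → ℝ} (ω : Env d κ ℓ) (n : ℕ) :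
    Kernel (Finset.Iic n → Site d) (Site d) :=
  Kernel.ofFunOfCountable fun h =>
    ∑ e : Dir d, ENNReal.ofReal (prob ω (h ⟨n, by simp⟩)
      (priorVisits (fun m => if hm : m ∈ Finset.Iic n then h ⟨m, hm⟩ else 0) n) e) •
        Measure.dirac (h ⟨n, by simp⟩ + e.vec)

theorem vec_injective {d : ℕ} : Function.Injective (Dir.vec (d := d)) := by
  rintro ⟨i, s⟩ ⟨j, t⟩ h
  have hi := congrFun h i
  have hs : (s : ℤ) ≠ 0 := s.ne_zero
  simp only [Dir.vec, Pi.single_eq_same] at hi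
  by_cases hij : i = j
  · subst hij
    simp only [Pi.single_eq_same] at hi
    rw [Units.ext hi]
  · rw [Pi.single_eq_of_ne hij] at hi
    exact absurd hi hs

theorem prob_nonneg {d : ℕ} {κ : ℝ} (hκ : 0 < κ) {ℓ : Fin d → ℝ} (ω : Env d κ ℓ) (x : Site d)
    (i : ℕ) (e : Dir d) : 0 ≤ prob ω x i e := hκ.le.trans ((ω x).2.1 i e).1

/-- A trajectory started from the point mass at `x` is at `x` at time `0`. -/
theorem map_zero_trajMeasure {S : Type} [MeasurableSpace S] (x : S)
    (K : (n : ℕ) → Kernel (Finset.Iic n → S) S) [∀ n, IsMarkovKernel (K n)] :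
    (Kernel.trajMeasure (X := fun _ => S) (Measure.dirac x) K).map (fun p => p 0) =
      Measure.dirac x := by
  have hg : Measurable fun h : Finset.Iic 0 → S => h ⟨0, by simp⟩ := measurable_pi_apply _
  have hr : Measurable (Preorder.frestrictLe (π := fun _ : ℕ => S) 0) := by fun_prop
  have hc : (fun p : ℕ → S => p 0) = (fun h : Finset.Iic 0 → S => h ⟨0, by simp⟩) ∘
      Preorder.frestrictLe (π := fun _ : ℕ => S) 0 := rfl
  rw [hc, ← Measure.map_map hg hr, Kernel.trajMeasure, Measure.map_comp _ _ hr,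
    Kernel.traj_map_frestrictLe, Kernel.partialTraj_self, Measure.id_comp,
    Measure.map_dirac' (MeasurableEquiv.measurable _), Measure.map_dirac' hg]
  rfl

/-- An excited random walk exists in every environment and from every starting point. -/
theorem exists_isERW {d : ℕ} {κ : ℝ} (hκ : 0 < κ) {ℓ : Fin d → ℝ} (ω : Env d κ ℓ) (x : Site d) :
    ∃ P : Measure (ℕ → Site d), IsProbabilityMeasure P ∧ IsERW ω x P (fun n p => p n) := by
  have : ∀ n, IsMarkovKernel (stepKernel ω n) := fun n => ⟨fun h => ⟨by
    change (∑ e : Dir d, _ • _ : Measure (Site d)) Set.univ = 1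
    simp only [Measure.coe_finsetSum, Measure.coe_smul, Finset.sum_apply, Pi.smul_apply,
      measure_univ, smul_eq_mul, mul_one]
    rw [← ENNReal.ofReal_sum_of_nonneg fun e _ => prob_nonneg hκ ω _ _ e]
    exact (congrArg _ ((ω _).2.2.1 _)).trans ENNReal.ofReal_one⟩⟩
  let P := Kernel.trajMeasure (X := fun _ => Site d) (Measure.dirac x) (stepKernel ω)
  refine ⟨P, inferInstance, fun n => measurable_pi_apply n, ?_, fun n e => ?_⟩
  · have h0 : P.map (fun p => p 0) = Measure.dirac x :=
      map_zero_trajMeasure x (stepKernel ω)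
    have hm : MeasurableSet {y : Site d | y = x} := MeasurableSet.of_discrete
    have : ∀ᵐ y ∂(P.map (fun p => p 0)), y = x := by
      rw [h0, ae_dirac_iff hm]
    exact ae_of_ae_map (measurable_pi_apply 0).aemeasurable this
  · have hX : Measurable (Preorder.frestrictLe (π := fun _ : ℕ => Site d) n) := by fun_prop
    let f : (Finset.Iic n → Site d) × Site d → ℝ :=
      Set.indicator {q | q.2 = q.1 ⟨n, by simp⟩ + e.vec} fun _ => 1
    have hS : MeasurableSet {q : (Finset.Iic n → Site d) × Site d |
      q.2 = q.1 ⟨n, by simp⟩ + e.vec} := MeasurableSet.of_discrete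
    have hf : StronglyMeasurable f := stronglyMeasurable_const.indicator hS
    have hY : Measurable fun p : ℕ → Site d => p (n + 1) := measurable_pi_apply _
    have key := condExp_prod_ae_eq_integral_condDistrib (μ := P) hX hY.aemeasurable hf
      (((integrable_const (1 : ℝ)).indicator (hS.preimage (hX.prodMk hY))))
    have h2 := ae_of_ae_map hX.aemeasurable
      (Kernel.condDistrib_trajMeasure (X := fun _ => Site d) (κ := stepKernel ω)
        (μ₀ := Measure.dirac x) (a := n))
    refine Filter.EventuallyEq.trans key ?_
    filter_upwards [h2] with p hp
    rw [hp]
    change ∫ y, f (Preorder.frestrictLe n p, y) ∂(∑ e : Dir d, _ • _ : Measure (Site d)) = _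
    rw [integral_finsetSum_measure]
    · simp only [integral_smul_measure, integral_dirac]
      rw [Finset.sum_eq_single e]
      · rw [ENNReal.toReal_ofReal (prob_nonneg hκ ω _ _ _)]
        have hv : priorVisits (fun m => if hm : m ∈ Finset.Iic n then
            Preorder.frestrictLe (π := fun _ : ℕ => Site d) n p ⟨m, hm⟩ else 0) n =
            priorVisits p n := by
          unfold priorVisits
          congr 1
          refine Finset.filter_congr fun m hm => ?_
          have hmn : m ≤ n := (Finset.mem_range.1 hm).le
          simp [hmn]
        have hmem : (Preorder.frestrictLe (π := fun _ : ℕ => Site d) n p, p n + e.vec) ∈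
            {q : (Finset.Iic n → Site d) × Site d | q.2 = q.1 ⟨n, by simp⟩ + e.vec} := rfl
        rw [hv]
        exact (congrArg _ (Set.indicator_of_mem hmem _)).trans (mul_one _)
      · intro e' _ he
        have : e'.vec ≠ e.vec := fun h => he (vec_injective h)
        simp [f, this]
      · simp
    · intro e' _
      exact (integrable_dirac (by simp [f])).smul_measure ENNReal.ofReal_ne_top

end ExcitedWalk

/-!
Let `P̄` be the law of the walk averaged over the environment. Since the environment is i.i.d., the
`P̄`-probability of a path is a product over the sites, so `P̄` is the law of a walk whose next
step depends only on the directions in which the present site has been left before (`localRule`,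
`meanRule`, `integral_weight`). This walk is uniformly elliptic, and its drift in direction `ℓ` is
never negative, and positive after some list of exits (`exists_drift_meanRule_pos`). After
averaging, no environment is left, and everything can be said about the expectations `step`, `hitP`,
`reward` of walks with history-dependent step probabilities (a `Rule`), over finitely many steps,
and about monotone limits of these.

*The averaged walk has a positive probability of never going to the left of its starting point*
(`Admissible.hitLim_neg_lt_one`). Suppose it has not. A walk at a record level sees fresh sites on
its right, whatever its rule on the left has become (`FreshRight`), and it almost surely goes to the
left of the record from every past (`FreshRight.hitLim_neg_eq_one`). As the level is a
submartingale, high levels are almost surely reached too (`Admissible.hitLim_le_level`). So the walk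
crosses a slab at the record infinitely often, and at each crossing it may, by ellipticity and
because `d ≥ 2`, walk along the slab; hence it visits infinitely many sites of the slab
(`FreshRight.hitLim_slabSites`). The possible rules on the left form a compact set, so the time
needed to visit `L` sites is bounded uniformly in them (`exists_uniform_hitP`). Thus the expected
number of sites visited before level `k` grows faster than any linear function of `k`. But each new
site yields, in expectation, a drift bounded from below, while the total drift collected before
level `k` is at most `k + 1` in expectation, by optional stopping (`Admissible.reward_drift_le`,
`Admissible.mul_reward_new_le`): a contradiction.

*Transience.* At each of infinitely many records the averaged walk has the same positive
probability of never going below the record, so it is almost surely below a given level only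
finitely often (`Admissible.hitInf_localRule_eq_zero`). By Fubini, the same holds for almost every
environment (`ae_iInf_iSup_expect_lateHit`), and then for every walk in such an environment, because
its conditional step probabilities determine the law of its history (`IsERW.integral_hist`).
-/

namespace ExcitedWalk

variable {d : ℕ} {κ : ℝ} {ℓ : Fin d → ℝ}

/-! ### Histories and their positions -/

/-- The position reached from `0` by the steps `h`. Histories are lists of steps, the *latest*
step being the head of the list. -/
def pos : List (Dir d) → Site d
  | [] => 0
  | e :: h => pos h + e.vec

/-- The level `x · ℓ` of the end point `x` of the history `h`. -/
noncomputable def level (ℓ : Fin d → ℝ) (h : List (Dir d)) : ℝ := proj ℓ (pos h)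

/-- The directions in which the history `h` has left the site `x`, the latest one first. -/
def exits : List (Dir d) → Site d → List (Dir d)
  | [], _ => []
  | e :: h, x => if pos h = x then e :: exits h x else exits h x

@[simp] theorem pos_nil : pos ([] : List (Dir d)) = 0 := rfl

@[simp] theorem pos_cons (e : Dir d) (h : List (Dir d)) : pos (e :: h) = pos h + e.vec := rfl

theorem proj_add (x y : Site d) : proj ℓ (x + y) = proj ℓ x + proj ℓ y := by
  simp [proj, add_mul, Finset.sum_add_distrib]

@[simp] theorem proj_zero : proj ℓ (0 : Site d) = 0 := by simp [proj]

theorem proj_vec (e : Dir d) : proj ℓ e.vec = ((e.2 : ℤ) : ℝ) * ℓ e.1 := by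
  rw [proj, Finset.sum_eq_single e.1]
  · simp [Dir.vec]
  · intro j _ hj
    simp [Dir.vec, Pi.single_eq_of_ne hj]
  · simp

theorem abs_proj_vec_le (hℓ : ∑ j, |ℓ j| = 1) (e : Dir d) : |proj ℓ e.vec| ≤ 1 := by
  have h1 : |((e.2 : ℤ) : ℝ)| = 1 := by
    rcases Int.units_eq_one_or e.2 with h | h <;> simp [h]
  rw [proj_vec, abs_mul, h1, one_mul, ← hℓ]
  exact Finset.single_le_sum (f := fun j => |ℓ j|) (fun _ _ => abs_nonneg _) (Finset.mem_univ e.1)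

theorem exists_dir_proj_nonneg (ℓ : Fin d → ℝ) (j : Fin d) :
    ∃ e : Dir d, e.1 = j ∧ proj ℓ e.vec = |ℓ j| := by
  rcases le_total 0 (ℓ j) with h | h
  · exact ⟨(j, 1), rfl, by rw [proj_vec, abs_of_nonneg h]; simp⟩
  · exact ⟨(j, -1), rfl, by rw [proj_vec, abs_of_nonpos h]; simp⟩

theorem exists_dir_proj_nonpos (ℓ : Fin d → ℝ) (j : Fin d) :
    ∃ e : Dir d, e.1 = j ∧ proj ℓ e.vec = -|ℓ j| := by
  rcases le_total 0 (ℓ j) with h | h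
  · exact ⟨(j, -1), rfl, by rw [proj_vec, abs_of_nonneg h]; simp⟩
  · exact ⟨(j, 1), rfl, by rw [proj_vec, abs_of_nonpos h]; simp⟩

theorem exists_dir_proj_pos (hℓ : ∑ j, |ℓ j| = 1) : ∃ e : Dir d, 0 < proj ℓ e.vec := by
  obtain ⟨j, hj⟩ : ∃ j, ℓ j ≠ 0 := by
    by_contra! h
    simp [h] at hℓ
  obtain ⟨e, -, he⟩ := exists_dir_proj_nonneg ℓ j
  exact ⟨e, he ▸ abs_pos.2 hj⟩

@[simp] theorem level_nil : level ℓ ([] : List (Dir d)) = 0 := proj_zero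

theorem level_cons (e : Dir d) (h : List (Dir d)) :
    level ℓ (e :: h) = level ℓ h + proj ℓ e.vec := proj_add _ _

theorem pos_append (t h : List (Dir d)) : pos (t ++ h) = pos t + pos h := by
  induction t with
  | nil => simp
  | cons e t ih => simp [ih]; abel

theorem level_append (t h : List (Dir d)) : level ℓ (t ++ h) = level ℓ t + level ℓ h := by
  rw [level, pos_append, proj_add]; rfl

theorem level_replicate (m : ℕ) (e : Dir d) :
    level ℓ (List.replicate m e) = m * proj ℓ e.vec := by
  induction m with
  | zero => simp
  | succ m ih => rw [List.replicate_succ, level_cons, ih]; push_cast; ring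

theorem level_cons_le (hℓ : ∑ j, |ℓ j| = 1) (e : Dir d) (h : List (Dir d)) :
    level ℓ (e :: h) ≤ level ℓ h + 1 := by
  rw [level_cons]; linarith [(abs_le.1 (abs_proj_vec_le hℓ e)).2]

theorem le_level_cons (hℓ : ∑ j, |ℓ j| = 1) (e : Dir d) (h : List (Dir d)) :
    level ℓ h - 1 ≤ level ℓ (e :: h) := by
  rw [level_cons]; linarith [(abs_le.1 (abs_proj_vec_le hℓ e)).1]

theorem level_le_length (hℓ : ∑ j, |ℓ j| = 1) (h : List (Dir d)) : level ℓ h ≤ h.length := by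
  induction h with
  | nil => simp
  | cons e h ih => have := level_cons_le hℓ e h; push_cast [List.length_cons]; linarith

theorem neg_length_le_level (hℓ : ∑ j, |ℓ j| = 1) (h : List (Dir d)) :
    -(h.length : ℝ) ≤ level ℓ h := by
  induction h with
  | nil => simp
  | cons e h ih => have := le_level_cons hℓ e h; push_cast [List.length_cons]; linarith

theorem exits_append (t h : List (Dir d)) (x : Site d) :
    exits (t ++ h) (x + pos h) = exits t x ++ exits h (x + pos h) := by
  induction t with
  | nil => simp [exits]
  | cons e t ih =>
    by_cases hx : pos t = x
    · simp [exits, pos_append, hx, ← ih]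
    · simp [exits, pos_append, hx, ← ih]

/-- The sites which the history `h` has left at least once. -/
def sites : List (Dir d) → Finset (Site d)
  | [] => ∅
  | _ :: h => insert (pos h) (sites h)

theorem exits_eq_nil_iff (h : List (Dir d)) (x : Site d) : exits h x = [] ↔ x ∉ sites h := by
  induction h with
  | nil => simp [exits, sites]
  | cons e h ih =>
    by_cases hx : pos h = x
    · simp [exits, sites, hx]
    · simp [exits, sites, hx, ih, Ne.symm hx]

theorem exists_suffix_of_mem_sites {e : Dir d} {h : List (Dir d)} {x : Site d}
    (hx : x ∈ sites (e :: h)) : ∃ t, t <:+ h ∧ pos t = x := by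
  induction h generalizing e with
  | nil => exact ⟨[], List.suffix_rfl, by simpa [sites, eq_comm] using hx⟩
  | cons e' h ih =>
    rw [sites, Finset.mem_insert] at hx
    rcases hx with rfl | hx
    · exact ⟨_, List.suffix_rfl, rfl⟩
    · obtain ⟨t, ht, hp⟩ := ih hx
      exact ⟨t, ht.trans (List.suffix_cons _ _), hp⟩

/-- The end point of the history `h` has a strictly larger level than all the sites that `h` has
left. -/
def IsRecord (ℓ : Fin d → ℝ) (h : List (Dir d)) : Prop := ∀ x ∈ sites h, proj ℓ x < level ℓ h

theorem isRecord_nil : IsRecord ℓ ([] : List (Dir d)) := by simp [IsRecord, sites]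

theorem isRecord_replicate {e : Dir d} (he : 0 < proj ℓ e.vec) (m : ℕ) :
    IsRecord ℓ (List.replicate m e) := by
  induction m with
  | zero => exact isRecord_nil
  | succ m ih =>
    intro x hx
    rw [List.replicate_succ, sites, Finset.mem_insert] at hx
    rw [List.replicate_succ, level_cons]
    rcases hx with rfl | hx
    · change level ℓ _ < _
      linarith
    · linarith [ih x hx]

/-- The level stays below `k` along the whole history `h`. -/
def Below (ℓ : Fin d → ℝ) (k : ℝ) (h : List (Dir d)) : Prop := ∀ t, t <:+ h → level ℓ t < k

theorem Below.isRecord {k : ℝ} {e : Dir d} {h : List (Dir d)} (hb : Below ℓ k h)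
    (hk : k ≤ level ℓ (e :: h)) : IsRecord ℓ (e :: h) := by
  intro x hx
  obtain ⟨t, ht, rfl⟩ := exists_suffix_of_mem_sites hx
  exact (hb t ht).trans_le hk

theorem Below.cons {k : ℝ} {e : Dir d} {h : List (Dir d)} (hb : Below ℓ k h)
    (hk : level ℓ (e :: h) < k) : Below ℓ k (e :: h) := by
  intro t ht
  rcases List.suffix_cons_iff.1 ht with rfl | ht
  · exact hk
  · exact hb t ht

theorem below_of_length_lt (hℓ : ∑ j, |ℓ j| = 1) {k : ℝ} {h : List (Dir d)}
    (hk : (h.length : ℝ) < k) : Below ℓ k h := fun t ht =>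
  (level_le_length hℓ t).trans_lt ((Nat.cast_le.2 ht.length_le).trans_lt hk)

/-! ### Walks with history-dependent step probabilities -/

/-- A rule assigns to each history the probabilities of the next step. -/
abbrev Rule (d : ℕ) : Type := List (Dir d) → Dir d → ℝ

/-- A rule is admissible if it is uniformly elliptic and never has a drift against `ℓ`. -/
structure Admissible (κ : ℝ) (ℓ : Fin d → ℝ) (q : Rule d) : Prop where
  κ_pos : 0 < κ
  le : ∀ h e, κ ≤ q h e
  sum_eq : ∀ h, ∑ e, q h e = 1
  drift_nonneg : ∀ h, 0 ≤ cookieDrift ℓ (q h)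

/-- The one-step expectation operator of a rule. -/
def step (q : Rule d) (F : List (Dir d) → ℝ) (h : List (Dir d)) : ℝ := ∑ e, q h e * F (e :: h)

namespace Admissible

variable {q : Rule d} (hq : Admissible κ ℓ q)
include hq

theorem nonneg (h : List (Dir d)) (e : Dir d) : 0 ≤ q h e := hq.κ_pos.le.trans (hq.le h e)

theorem step_mono {F F' : List (Dir d) → ℝ} {h : List (Dir d)}
    (hF : ∀ e, F (e :: h) ≤ F' (e :: h)) : step q F h ≤ step q F' h :=
  Finset.sum_le_sum fun e _ => mul_le_mul_of_nonneg_left (hF e) (hq.nonneg h e)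

theorem step_const (c : ℝ) (h : List (Dir d)) : step q (fun _ => c) h = c := by
  rw [step, ← Finset.sum_mul, hq.sum_eq, one_mul]

theorem step_le {F : List (Dir d) → ℝ} {c : ℝ} {h : List (Dir d)} (hF : ∀ e, F (e :: h) ≤ c) :
    step q F h ≤ c := (hq.step_mono (F' := fun _ => c) hF).trans (hq.step_const c h).le

theorem le_step {F : List (Dir d) → ℝ} {c : ℝ} {h : List (Dir d)} (hF : ∀ e, c ≤ F (e :: h)) :
    c ≤ step q F h := (hq.step_const c h).ge.trans (hq.step_mono (F := fun _ => c) hF)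

/-- A single direction contributes at least `κ` of its excess over a lower bound. -/
theorem add_le_step {F : List (Dir d) → ℝ} {c : ℝ} {h : List (Dir d)} (hF : ∀ e, c ≤ F (e :: h))
    (e : Dir d) : κ * (F (e :: h) - c) + c ≤ step q F h := by
  have h1 : step q F h = ∑ e, q h e * (F (e :: h) - c) + c := by
    simp only [mul_sub, Finset.sum_sub_distrib, ← Finset.sum_mul, hq.sum_eq, step]; ring
  have h2 : q h e * (F (e :: h) - c) ≤ ∑ e, q h e * (F (e :: h) - c) :=
    Finset.single_le_sum (f := fun e => q h e * (F (e :: h) - c))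
      (fun e _ => mul_nonneg (hq.nonneg h e) (sub_nonneg.2 (hF e))) (Finset.mem_univ e)
  have h3 := mul_le_mul_of_nonneg_right (hq.le h e) (sub_nonneg.2 (hF e))
  linarith

end Admissible

theorem step_add (q : Rule d) (F F' : List (Dir d) → ℝ) (h : List (Dir d)) :
    step q (fun h => F h + F' h) h = step q F h + step q F' h := by
  simp [step, mul_add, Finset.sum_add_distrib]

theorem step_sub (q : Rule d) (F F' : List (Dir d) → ℝ) (h : List (Dir d)) :
    step q (fun h => F h - F' h) h = step q F h - step q F' h := by
  simp [step, mul_sub, Finset.sum_sub_distrib]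

theorem step_const_mul (q : Rule d) (c : ℝ) (F : List (Dir d) → ℝ) (h : List (Dir d)) :
    step q (fun h => c * F h) h = c * step q F h := by
  simp only [step, Finset.mul_sum]
  exact Finset.sum_congr rfl fun e _ => by ring

theorem Admissible.step_level {q : Rule d} (hq : Admissible κ ℓ q) (h : List (Dir d)) :
    step q (level ℓ) h = level ℓ h + cookieDrift ℓ (q h) := by
  simp only [step, level_cons, mul_add, Finset.sum_add_distrib, ← Finset.sum_mul, hq.sum_eq,
    one_mul, cookieDrift]

/-! ### Hitting probabilities -/

open Classical in
/-- The probability that the walk with rule `q` and past `h` has a history in `B` now or within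
the next `n` steps. -/
noncomputable def hitP (q : Rule d) (B : Set (List (Dir d))) : ℕ → List (Dir d) → ℝ
  | 0, h => if h ∈ B then 1 else 0
  | n + 1, h => if h ∈ B then 1 else step q (hitP q B n) h

/-- The probability that the walk with rule `q` and past `h` has a history in `B` now or later. -/
noncomputable def hitLim (q : Rule d) (B : Set (List (Dir d))) (h : List (Dir d)) : ℝ :=
  ⨆ n, hitP q B n h

theorem hitP_of_mem {q : Rule d} {B : Set (List (Dir d))} {h : List (Dir d)} (hB : h ∈ B) (n : ℕ) :
    hitP q B n h = 1 := by cases n <;> simp [hitP, hB]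

theorem hitLim_of_mem {q : Rule d} {B : Set (List (Dir d))} {h : List (Dir d)} (hB : h ∈ B) :
    hitLim q B h = 1 := by simp [hitLim, hitP_of_mem hB]

theorem hitP_zero_of_notMem {q : Rule d} {B : Set (List (Dir d))} {h : List (Dir d)}
    (hB : h ∉ B) : hitP q B 0 h = 0 := by simp [hitP, hB]

theorem hitP_succ_of_notMem {q : Rule d} {B : Set (List (Dir d))} {h : List (Dir d)}
    (hB : h ∉ B) (n : ℕ) : hitP q B (n + 1) h = step q (hitP q B n) h := by simp [hitP, hB]

theorem continuous_hitP (B : Set (List (Dir d))) (n : ℕ) (h : List (Dir d)) :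
    Continuous fun q : Rule d => hitP q B n h := by
  induction n generalizing h with
  | zero => simp only [hitP]; exact continuous_const
  | succ n ih =>
    by_cases hB : h ∈ B
    · simp only [hitP_of_mem hB]; exact continuous_const
    · simp only [hitP_succ_of_notMem hB, step]
      exact continuous_finsetSum _ fun e _ =>
        (continuous_apply_apply h e).mul (ih (e :: h))

namespace Admissible

variable {q : Rule d} (hq : Admissible κ ℓ q) {B : Set (List (Dir d))}
include hq

theorem hitP_nonneg (n : ℕ) (h : List (Dir d)) : 0 ≤ hitP q B n h := by
  induction n generalizing h with
  | zero => by_cases hB : h ∈ B <;> simp [hitP, hB]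
  | succ n ih =>
    by_cases hB : h ∈ B
    · simp [hitP, hB]
    · rw [hitP_succ_of_notMem hB]; exact hq.le_step fun e => ih _

theorem hitP_le_one (n : ℕ) (h : List (Dir d)) : hitP q B n h ≤ 1 := by
  induction n generalizing h with
  | zero => by_cases hB : h ∈ B <;> simp [hitP, hB]
  | succ n ih =>
    by_cases hB : h ∈ B
    · simp [hitP, hB]
    · rw [hitP_succ_of_notMem hB]; exact hq.step_le fun e => ih _

theorem hitP_le_succ (n : ℕ) (h : List (Dir d)) : hitP q B n h ≤ hitP q B (n + 1) h := by
  induction n generalizing h with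
  | zero =>
    by_cases hB : h ∈ B
    · simp [hitP, hB]
    · rw [hitP_zero_of_notMem hB]; exact hq.hitP_nonneg _ _
  | succ n ih =>
    by_cases hB : h ∈ B
    · simp [hitP, hB]
    · rw [hitP_succ_of_notMem hB, hitP_succ_of_notMem hB]; exact hq.step_mono fun e => ih _

theorem monotone_hitP (h : List (Dir d)) : Monotone fun n => hitP q B n h :=
  monotone_nat_of_le_succ fun n => hq.hitP_le_succ n h

theorem bddAbove_hitP (h : List (Dir d)) : BddAbove (Set.range fun n => hitP q B n h) :=
  ⟨1, by rintro _ ⟨n, rfl⟩; exact hq.hitP_le_one n h⟩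

theorem tendsto_hitP (h : List (Dir d)) :
    Filter.Tendsto (fun n => hitP q B n h) Filter.atTop (nhds (hitLim q B h)) :=
  tendsto_atTop_ciSup (hq.monotone_hitP h) (hq.bddAbove_hitP h)

theorem hitP_le_hitLim (n : ℕ) (h : List (Dir d)) : hitP q B n h ≤ hitLim q B h :=
  le_ciSup (hq.bddAbove_hitP h) n

theorem hitLim_nonneg (h : List (Dir d)) : 0 ≤ hitLim q B h :=
  (hq.hitP_nonneg 0 h).trans (hq.hitP_le_hitLim 0 h)

theorem hitLim_le_one (h : List (Dir d)) : hitLim q B h ≤ 1 :=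
  ciSup_le fun n => hq.hitP_le_one n h

theorem hitLim_of_notMem {h : List (Dir d)} (hB : h ∉ B) :
    hitLim q B h = step q (hitLim q B) h := by
  refine tendsto_nhds_unique ((hq.tendsto_hitP h).comp (Filter.tendsto_add_atTop_nat 1)) ?_
  have : ((fun n => hitP q B n h) ∘ fun n => n + 1) = fun n => ∑ e, q h e * hitP q B n (e :: h) :=
    funext fun n => hitP_succ_of_notMem hB n
  rw [this]
  exact tendsto_finsetSum _ fun e _ => (hq.tendsto_hitP (e :: h)).const_mul _

theorem step_hitLim_le (h : List (Dir d)) : step q (hitLim q B) h ≤ hitLim q B h := by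
  by_cases hB : h ∈ B
  · rw [hitLim_of_mem hB]; exact hq.step_le fun e => hq.hitLim_le_one _
  · exact (hq.hitLim_of_notMem hB).ge

theorem hitP_mono_set {B' : Set (List (Dir d))} (hBB : B ⊆ B') (n : ℕ) (h : List (Dir d)) :
    hitP q B n h ≤ hitP q B' n h := by
  induction n generalizing h with
  | zero =>
    by_cases hB : h ∈ B
    · rw [hitP_of_mem hB, hitP_of_mem (hBB hB)]
    · rw [hitP_zero_of_notMem hB]; exact hq.hitP_nonneg _ _
  | succ n ih =>
    by_cases hB : h ∈ B'
    · rw [hitP_of_mem hB]; exact hq.hitP_le_one _ _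
    · rw [hitP_succ_of_notMem hB, hitP_succ_of_notMem fun h' => hB (hBB h')]
      exact hq.step_mono fun e => ih _

theorem hitLim_mono_set {B' : Set (List (Dir d))} (hBB : B ⊆ B') (h : List (Dir d)) :
    hitLim q B h ≤ hitLim q B' h :=
  ciSup_mono (hq.bddAbove_hitP h) fun n => hq.hitP_mono_set hBB n h

/-- Optional stopping: a nonnegative function that is superharmonic off `B` and at least `c` on
`B` dominates `c` times the probability of hitting `B`. -/
theorem mul_hitLim_le {ψ : List (Dir d) → ℝ} {c : ℝ} (h0 : ∀ h, 0 ≤ ψ h)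
    (hc : ∀ h ∈ B, c ≤ ψ h) (hs : ∀ h ∉ B, step q ψ h ≤ ψ h) (h : List (Dir d)) :
    c * hitLim q B h ≤ ψ h := by
  refine le_of_tendsto ((hq.tendsto_hitP h).const_mul c) (.of_forall fun n => ?_)
  induction n generalizing h with
  | zero =>
    by_cases hB : h ∈ B
    · simpa [hitP_of_mem hB] using hc h hB
    · simpa [hitP_zero_of_notMem hB] using h0 h
  | succ n ih =>
    by_cases hB : h ∈ B
    · simpa [hitP_of_mem hB] using hc h hB
    · rw [hitP_succ_of_notMem hB, ← step_const_mul]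
      exact (hq.step_mono fun e => ih _).trans (hs h hB)

/-- By ellipticity, a superharmonic function that is at least `1` on `B` exceeds its lower bounds
`m` by `κ ^ b * (1 - m)` wherever `B` can be reached in `b` steps. -/
theorem route_le {f : List (Dir d) → ℝ} {m : ℝ} (hf : ∀ h, step q f h ≤ f h) (hm : ∀ h, m ≤ f h)
    (h1 : ∀ h ∈ B, 1 ≤ f h) (t h : List (Dir d)) (ht : t ++ h ∈ B) :
    κ ^ t.length * (1 - m) + m ≤ f h := by
  have key : ∀ t : List (Dir d), κ ^ t.length * (f (t ++ h) - m) + m ≤ f h := by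
    intro t
    induction t with
    | nil => simp
    | cons e t ih =>
      refine le_trans ?_ ih
      have := (hq.add_le_step (fun e => hm (e :: (t ++ h))) e).trans (hf (t ++ h))
      have h2 : κ * (f (e :: (t ++ h)) - m) ≤ f (t ++ h) - m := by linarith
      have := mul_le_mul_of_nonneg_left h2 (pow_nonneg hq.κ_pos.le t.length)
      rw [List.length_cons, pow_succ, mul_assoc, List.cons_append]
      linarith
  have h3 := mul_le_mul_of_nonneg_left (sub_le_sub_right (h1 _ ht) m)
    (pow_nonneg hq.κ_pos.le t.length)
  linarith [key t]

end Admissible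

/-- If the infimum `m` of a function bounded below improves to `c * (1 - m) + m` everywhere, then
the function is at least `1`. -/
theorem one_le_of_improves {f : List (Dir d) → ℝ} {c : ℝ} (hc : 0 < c)
    (h0 : ∀ h, 0 ≤ f h) (himp : ∀ m, 0 ≤ m → (∀ h, m ≤ f h) → ∀ h, c * (1 - m) + m ≤ f h)
    (h : List (Dir d)) : 1 ≤ f h := by
  have hb : BddBelow (Set.range f) := ⟨0, by rintro _ ⟨h, rfl⟩; exact h0 h⟩
  have hm : ∀ h, (⨅ h, f h) ≤ f h := fun h => ciInf_le hb h
  have h2 := le_ciInf (himp _ (Real.iInf_nonneg h0) hm)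
  refine le_trans ?_ (hm h)
  by_contra! hlt
  nlinarith [mul_pos hc (sub_pos.2 hlt)]

/-! ### High levels are always reached -/

namespace Admissible

variable {q : Rule d} (hq : Admissible κ ℓ q)
include hq

/-- A step changes the level by at most one, so that `k + 1 - level` is nonnegative until the walk
has reached the level `k`. -/
theorem step_max_level_le (hℓ : ∑ j, |ℓ j| = 1) {k : ℝ} {h : List (Dir d)} (hk : level ℓ h < k) :
    step q (fun h => max (k + 1 - level ℓ h) 0) h ≤ max (k + 1 - level ℓ h) 0 := by
  have h1 : step q (fun h => max (k + 1 - level ℓ h) 0) h = step q (fun h => k + 1 - level ℓ h) h :=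
    Finset.sum_congr rfl fun e _ => by
      dsimp only
      rw [max_eq_left]
      linarith [level_cons_le hℓ e h]
  rw [h1, step_sub, hq.step_const, hq.step_level]
  exact le_max_of_le_left (by linarith [hq.drift_nonneg h])

/-- Ellipticity makes the walk leave every bounded slab. -/
theorem hitLim_exit_slab (hℓ : ∑ j, |ℓ j| = 1) (k M : ℝ) (h : List (Dir d)) :
    hitLim q {h | k ≤ level ℓ h ∨ level ℓ h < -M} h = 1 := by
  -- `b` steps in a direction `e` with `e · ℓ > 0` lead from any level `≥ -M` to a level `≥ k`.
  obtain ⟨e, he⟩ := exists_dir_proj_pos hℓ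
  obtain ⟨b, hb⟩ := exists_nat_ge ((k + M) / proj ℓ e.vec)
  rw [div_le_iff₀ he] at hb
  refine le_antisymm (hq.hitLim_le_one h) (one_le_of_improves (pow_pos hq.κ_pos b)
    hq.hitLim_nonneg (fun m _ hm h => ?_) h)
  by_cases hM : level ℓ h < -M
  · rw [hitLim_of_mem (Set.mem_ofPred.2 (Or.inr hM))]
    have hm1 := (hm h).trans (hq.hitLim_le_one h)
    have hκ1 : κ ^ b ≤ 1 := by
      refine pow_le_one₀ hq.κ_pos.le ((hq.le h e).trans ?_)
      rw [← hq.sum_eq h]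
      exact Finset.single_le_sum (fun e _ => hq.nonneg h e) (Finset.mem_univ e)
    nlinarith
  · have := hq.route_le hq.step_hitLim_le hm (fun h hB => (hitLim_of_mem hB).ge)
      (List.replicate b e) h (Or.inl (by rw [level_append, level_replicate]; linarith))
    rwa [List.length_replicate] at this

/-- The level is a submartingale that leaves all bounded slabs, so it exceeds every `k`. -/
theorem hitLim_le_level (hℓ : ∑ j, |ℓ j| = 1) (k : ℝ) (h : List (Dir d)) :
    hitLim q {h | k ≤ level ℓ h} h = 1 := by
  refine le_antisymm (hq.hitLim_le_one h) ?_
  -- The probability of sinking below `k - n` before reaching `k` is at most `A / (n + 1)`.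
  set A := max (k + 1 - level ℓ h) 0 with hA
  have key : ∀ n : ℕ, 1 - A * ((n : ℝ) + 1)⁻¹ ≤ hitLim q {h | k ≤ level ℓ h} h := by
    intro n
    have hn : (0 : ℝ) < (n : ℝ) + 1 := by positivity
    have := hq.mul_hitLim_le (B := {h | k ≤ level ℓ h ∨ level ℓ h < -(n - k)}) (c := 1)
      (ψ := fun h => hitLim q {h | k ≤ level ℓ h} h +
        ((n : ℝ) + 1)⁻¹ * max (k + 1 - level ℓ h) 0)
      (fun h => add_nonneg (hq.hitLim_nonneg h) (by positivity)) ?_ ?_ h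
    · rw [hq.hitLim_exit_slab hℓ, mul_one] at this
      linarith
    · rintro h (hB | hB)
      · rw [hitLim_of_mem (Set.mem_ofPred.2 hB)]
        exact le_add_of_nonneg_right (by positivity)
      · refine le_add_of_nonneg_of_le (hq.hitLim_nonneg h) ?_
        rw [inv_mul_eq_div, one_le_div hn]
        exact le_max_of_le_left (by linarith)
    · intro h hB
      rw [step_add, step_const_mul]
      have hk : level ℓ h < k := not_le.1 fun h' => hB (Or.inl h')
      exact add_le_add (hq.step_hitLim_le h)
        (mul_le_mul_of_nonneg_left (hq.step_max_level_le hℓ hk) (by positivity))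
  have hlim : Filter.Tendsto (fun n : ℕ => 1 - A * ((n : ℝ) + 1)⁻¹) Filter.atTop (nhds 1) := by
    have := (tendsto_one_div_add_atTop_nhds_zero_nat (𝕜 := ℝ)).const_mul A
    simpa [one_div] using this.const_sub 1
  exact le_of_tendsto hlim (.of_forall key)

end Admissible

/-! ### Local rules, and rules that are local on the right -/

/-- A local rule: the step from a site depends only on the directions in which the site has been
left before. Averaging over an i.i.d. environment produces such a rule. -/
def localRule (g : Rule d) : Rule d := fun h => g (exits h (pos h))

/-- The rule for the continuation of the history `h₀`. -/
def shift (q : Rule d) (h₀ : List (Dir d)) : Rule d := fun h => q (h ++ h₀)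

/-- Rules that agree with the local rule given by `g` at the sites of level `≥ 0`. Nothing but
admissibility is required at the sites of level `< 0`. -/
structure FreshRight (κ : ℝ) (ℓ : Fin d → ℝ) (g q : Rule d) : Prop extends Admissible κ ℓ q where
  eq_local : ∀ h, 0 ≤ level ℓ h → q h = g (exits h (pos h))

theorem Admissible.toLocal {g : Rule d} (hg : Admissible κ ℓ g) :
    Admissible κ ℓ (localRule g) :=
  ⟨hg.κ_pos, fun _ => hg.le _, fun _ => hg.sum_eq _, fun _ => hg.drift_nonneg _⟩

theorem Admissible.freshRight_localRule {g : Rule d} (hg : Admissible κ ℓ g) :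
    FreshRight κ ℓ g (localRule g) := ⟨hg.toLocal, fun _ _ => rfl⟩

theorem IsRecord.notMem_sites {h₀ : List (Dir d)} (h₀r : IsRecord ℓ h₀) {h : List (Dir d)}
    (hh : 0 ≤ level ℓ h) : pos (h ++ h₀) ∉ sites h₀ := fun hx => by
  have := h₀r _ hx
  change level ℓ (h ++ h₀) < _ at this
  rw [level_append] at this
  linarith

theorem IsRecord.exits_append {h₀ : List (Dir d)} (h₀r : IsRecord ℓ h₀) {h : List (Dir d)}
    (hh : 0 ≤ level ℓ h) : exits (h ++ h₀) (pos (h ++ h₀)) = exits h (pos h) := by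
  have h1 := (exits_eq_nil_iff h₀ _).2 (h₀r.notMem_sites hh)
  rw [pos_append] at h1 ⊢
  rw [ExcitedWalk.exits_append, h1, List.append_nil]

/-- After a record, the walk sees only fresh sites on its right. -/
theorem IsRecord.freshRight_shift {h₀ : List (Dir d)} (h₀r : IsRecord ℓ h₀) {g : Rule d}
    (hg : Admissible κ ℓ g) : FreshRight κ ℓ g (shift (localRule g) h₀) :=
  ⟨⟨hg.κ_pos, fun _ => hg.le _, fun _ => hg.sum_eq _, fun _ => hg.drift_nonneg _⟩, fun h hh => by
    simp only [shift, localRule, h₀r.exits_append hh]⟩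

theorem hitP_shift (q : Rule d) (h₀ : List (Dir d)) (B : Set (List (Dir d))) (n : ℕ)
    (h : List (Dir d)) : hitP (shift q h₀) {h | h ++ h₀ ∈ B} n h = hitP q B n (h ++ h₀) := by
  induction n generalizing h with
  | zero => simp [hitP]
  | succ n ih =>
    by_cases hB : h ++ h₀ ∈ B
    · rw [hitP_of_mem (B := B) hB, hitP_of_mem (h := h) hB]
    · rw [hitP_succ_of_notMem (B := B) hB, hitP_succ_of_notMem (h := h) hB]
      simp only [step, ih]
      rfl

theorem hitLim_shift (q : Rule d) (h₀ : List (Dir d)) (B : Set (List (Dir d)))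
    (h : List (Dir d)) : hitLim (shift q h₀) {h | h ++ h₀ ∈ B} h = hitLim q B (h ++ h₀) := by
  simp only [hitLim, hitP_shift]

theorem FreshRight.hitP_neg_eq {g q q' : Rule d} (hq : FreshRight κ ℓ g q)
    (hq' : FreshRight κ ℓ g q') (n : ℕ) (h : List (Dir d)) :
    hitP q {h | level ℓ h < 0} n h = hitP q' {h | level ℓ h < 0} n h := by
  induction n generalizing h with
  | zero => simp [hitP]
  | succ n ih =>
    by_cases hB : level ℓ h < 0
    · rw [hitP_of_mem (Set.mem_ofPred.2 hB), hitP_of_mem (Set.mem_ofPred.2 hB)]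
    · rw [hitP_succ_of_notMem (mt Set.mem_ofPred.1 hB),
        hitP_succ_of_notMem (mt Set.mem_ofPred.1 hB)]
      simp only [step, ih, hq.eq_local h (not_lt.1 hB), hq'.eq_local h (not_lt.1 hB)]

/-- The probability of ever going to the left of the origin is the same for all rules that are
local on the right, as it depends only on what happens before. -/
theorem FreshRight.hitLim_neg_eq {g q q' : Rule d} (hq : FreshRight κ ℓ g q)
    (hq' : FreshRight κ ℓ g q') (h : List (Dir d)) :
    hitLim q {h | level ℓ h < 0} h = hitLim q' {h | level ℓ h < 0} h := by
  simp only [hitLim, hq.hitP_neg_eq hq']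

/-- From a record on, the probability of ever going below the level of the record is the
probability with which a fresh walk goes below its starting level. -/
theorem IsRecord.hitLim_lt_level {h₀ : List (Dir d)} (h₀r : IsRecord ℓ h₀) {g : Rule d}
    (hg : Admissible κ ℓ g) :
    hitLim (localRule g) {h | level ℓ h < level ℓ h₀} h₀ =
      hitLim (localRule g) {h | level ℓ h < 0} [] := by
  rw [hg.freshRight_localRule.hitLim_neg_eq (h₀r.freshRight_shift hg)]
  have := hitLim_shift (localRule g) h₀ {h | level ℓ h < level ℓ h₀} []
  rw [List.nil_append] at this
  rw [← this]
  congr 1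
  ext h
  simp [level_append]

/-! ### A recurrent walk returns from every past -/

/-- If from `h` there is a route off `B`, then hitting `B` cannot be certain for `h` unless it is
certain at the end of the route. -/
theorem Admissible.hitLim_eq_one_of_route {q : Rule d} (hq : Admissible κ ℓ q)
    {B : Set (List (Dir d))} {h : List (Dir d)} (h1 : hitLim q B h = 1) (t : List (Dir d))
    (ht : ∀ s, s <:+ t → s ++ h ∉ B) : hitLim q B (t ++ h) = 1 := by
  induction t with
  | nil => exact h1
  | cons e t ih =>
    have h2 := ih fun s hs => ht s (hs.trans (List.suffix_cons _ _))
    rw [hq.hitLim_of_notMem (ht t (List.suffix_cons _ _))] at h2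
    have h3 : ∑ e, q (t ++ h) e * (1 - hitLim q B (e :: (t ++ h))) = 0 := by
      simp only [mul_sub, mul_one, Finset.sum_sub_distrib, hq.sum_eq]
      exact sub_eq_zero.2 h2.symm
    have h4 := (Finset.sum_eq_zero_iff_of_nonneg fun e _ => mul_nonneg (hq.nonneg _ e)
      (sub_nonneg.2 (hq.hitLim_le_one _))).1 h3 e (Finset.mem_univ e)
    rcases mul_eq_zero.1 h4 with h5 | h5
    · exact absurd h5 (hq.κ_pos.trans_le (hq.le _ e)).ne'
    · exact (sub_eq_zero.1 h5).symm

/-- If a fresh walk almost surely goes to the left of its starting point, then so does every walk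
that is local on the right, whatever its past: a fresh walk can imitate the past `h`, after a straight
walk to the right that is long enough for it not to leave the right half-space meanwhile. -/
theorem FreshRight.hitLim_neg_eq_one (hℓ : ∑ j, |ℓ j| = 1) {g q : Rule d}
    (hg : Admissible κ ℓ g) (hrec : hitLim (localRule g) {h | level ℓ h < 0} [] = 1)
    (hq : FreshRight κ ℓ g q) (h : List (Dir d)) : hitLim q {h | level ℓ h < 0} h = 1 := by
  obtain ⟨e, he⟩ := exists_dir_proj_pos hℓ
  obtain ⟨m, hm⟩ := exists_nat_ge (h.length / proj ℓ e.vec)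
  rw [div_le_iff₀ he] at hm
  have hr := isRecord_replicate he m
  rw [hq.hitLim_neg_eq (hr.freshRight_shift hg)]
  have h1 : hitLim (localRule g) {h | level ℓ h < 0} (List.replicate m e) = 1 := by
    have := hg.toLocal.hitLim_eq_one_of_route hrec (List.replicate m e) fun s hs => by
      rw [List.append_nil, (List.suffix_replicate_iff.1 hs).2, Set.mem_ofPred, level_replicate]
      exact not_lt.2 (by positivity)
    rwa [List.append_nil] at this
  have h2 := hg.toLocal.hitLim_eq_one_of_route h1 h fun s hs => by
    rw [Set.mem_ofPred, level_append, level_replicate, not_lt]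
    have h3 : (s.length : ℝ) ≤ h.length := Nat.cast_le.2 hs.length_le
    linarith [neg_length_le_level hℓ s]
  refine le_antisymm ((hr.freshRight_shift hg).hitLim_le_one h) ?_
  rw [← h2, ← hitLim_shift]
  refine (hr.freshRight_shift hg).hitLim_mono_set (fun t ht => ?_) h
  rw [Set.mem_ofPred, Set.mem_ofPred, level_append, level_replicate] at ht
  rw [Set.mem_ofPred]
  nlinarith [mul_nonneg (Nat.cast_nonneg (α := ℝ) m) he.le]

/-! ### A recurrent walk visits infinitely many sites of a slab -/

open Classical in
/-- The sites of level in `[0, 2)` which the history `h` has left. -/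
noncomputable def slabSites (ℓ : Fin d → ℝ) (h : List (Dir d)) : Finset (Site d) :=
  (sites h).filter fun x => proj ℓ x ∈ Set.Ico (0 : ℝ) 2

/-- In dimension at least two a walk can stay in a slab of width `2` for any number of steps without
visiting a site twice, by using one direction of nonpositive and one of nonnegative drift on two
different axes. -/
theorem exists_route_slabSites (hd : 2 ≤ d) (hℓ : ∑ j, |ℓ j| = 1) (L : ℕ) {h : List (Dir d)}
    (hh : level ℓ h ∈ Set.Ico (0 : ℝ) 2) :
    ∃ t : List (Dir d), t.length = L ∧ L ≤ (slabSites ℓ (t ++ h)).card := by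
  obtain ⟨u, hu0, hu⟩ := exists_dir_proj_nonpos ℓ (⟨0, by omega⟩ : Fin d)
  obtain ⟨v, hv1, hv⟩ := exists_dir_proj_nonneg ℓ (⟨1, by omega⟩ : Fin d)
  have huv : u.1 ≠ v.1 := by rw [hu0, hv1]; simp
  -- Every step along `u` or `v` increases `s` by one.
  let s : Site d → ℤ := fun x => (u.2 : ℤ) * x u.1 + (v.2 : ℤ) * x v.1
  have hsu : ∀ x, s (x + u.vec) = s x + 1 := fun x => by
    have h2 : (u.2 : ℤ) * (u.2 : ℤ) = 1 := by
      rw [← Units.val_mul, Int.units_mul_self, Units.val_one]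
    simp only [s, Dir.vec, Pi.add_apply, Pi.single_eq_same, Pi.single_eq_of_ne huv.symm]
    linear_combination h2
  have hsv : ∀ x, s (x + v.vec) = s x + 1 := fun x => by
    have h2 : (v.2 : ℤ) * (v.2 : ℤ) = 1 := by
      rw [← Units.val_mul, Int.units_mul_self, Units.val_one]
    simp only [s, Dir.vec, Pi.add_apply, Pi.single_eq_same, Pi.single_eq_of_ne huv]
    linear_combination h2
  have key : ∀ n : ℕ, ∃ t : List (Dir d), t.length = n ∧ level ℓ (t ++ h) ∈ Set.Ico (0 : ℝ) 2 ∧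
      s (pos (t ++ h)) = s (pos h) + n ∧
      ∀ i : ℕ, i < n → ∃ x ∈ slabSites ℓ (t ++ h), s x = s (pos h) + i := by
    intro n
    induction n with
    | zero => exact ⟨[], rfl, hh, by simp, by simp⟩
    | succ n ih =>
      obtain ⟨t, htn, htl, hts, hti⟩ := ih
      have next : ∀ e : Dir d, s (pos (t ++ h) + e.vec) = s (pos (t ++ h)) + 1 →
          level ℓ (e :: (t ++ h)) ∈ Set.Ico (0 : ℝ) 2 →
          ∃ t : List (Dir d), t.length = n + 1 ∧ level ℓ (t ++ h) ∈ Set.Ico (0 : ℝ) 2 ∧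
          s (pos (t ++ h)) = s (pos h) + (n + 1 : ℕ) ∧
          ∀ i : ℕ, i < n + 1 → ∃ x ∈ slabSites ℓ (t ++ h), s x = s (pos h) + i := by
        intro e he hl
        refine ⟨e :: t, by simp [htn], hl, ?_, fun i hi => ?_⟩
        · rw [List.cons_append, pos_cons, he, hts]; push_cast; ring
        · rcases Nat.lt_succ_iff_lt_or_eq.1 hi with hi | rfl
          · obtain ⟨x, hx, hxs⟩ := hti i hi
            refine ⟨x, ?_, hxs⟩
            simp only [slabSites, Finset.mem_filter, List.cons_append, sites,
              Finset.mem_insert] at hx ⊢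
            exact ⟨Or.inr hx.1, hx.2⟩
          · refine ⟨pos (t ++ h), ?_, hts⟩
            simp only [slabSites, Finset.mem_filter, List.cons_append, sites, Finset.mem_insert]
            exact ⟨by simp, htl⟩
      have au := (abs_le.1 (abs_proj_vec_le hℓ u)).1
      have av := (abs_le.1 (abs_proj_vec_le hℓ v)).2
      have pu : proj ℓ u.vec ≤ 0 := hu ▸ neg_nonpos.2 (abs_nonneg _)
      have pv : 0 ≤ proj ℓ v.vec := hv ▸ abs_nonneg _
      by_cases h1 : 1 ≤ level ℓ (t ++ h)
      · refine next u (hsu _) ?_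
        rw [level_cons]
        exact ⟨by linarith, by linarith [htl.2]⟩
      · refine next v (hsv _) ?_
        rw [level_cons]
        exact ⟨by linarith [htl.1], by linarith⟩
  obtain ⟨t, htn, -, -, hti⟩ := key L
  refine ⟨t, htn, ?_⟩
  have hsub : (Finset.range L).image (fun i : ℕ => s (pos h) + (i : ℤ)) ⊆
      (slabSites ℓ (t ++ h)).image s := by
    intro z hz
    obtain ⟨i, hi, rfl⟩ := Finset.mem_image.1 hz
    obtain ⟨x, hx, hxs⟩ := hti i (Finset.mem_range.1 hi)
    exact Finset.mem_image.2 ⟨x, hx, hxs⟩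
  have h1 := (Finset.card_le_card hsub).trans Finset.card_image_le
  rwa [Finset.card_image_of_injective _ (fun i j hij => by simpa using hij),
    Finset.card_range] at h1

/-- A walk cannot jump over the slab of levels `[0, 2)`. -/
theorem Admissible.hitLim_nonneg_le_hitLim_Ico (hℓ : ∑ j, |ℓ j| = 1) {q : Rule d}
    (hq : Admissible κ ℓ q) {h : List (Dir d)} (hh : level ℓ h < 0) :
    hitLim q {h | 0 ≤ level ℓ h} h ≤ hitLim q {h | level ℓ h ∈ Set.Ico (0 : ℝ) 2} h := by
  refine ciSup_mono (hq.bddAbove_hitP h) fun n => ?_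
  have key : ∀ n h, level ℓ h < 1 → hitP q {h | 0 ≤ level ℓ h} n h ≤
      hitP q {h | level ℓ h ∈ Set.Ico (0 : ℝ) 2} n h := by
    intro n
    induction n with
    | zero =>
      intro h hh
      by_cases h0 : 0 ≤ level ℓ h
      · rw [hitP_of_mem (B := {h | level ℓ h ∈ Set.Ico (0 : ℝ) 2}) ⟨h0, by linarith⟩]
        exact hq.hitP_le_one _ _
      · rw [hitP_zero_of_notMem (mt Set.mem_ofPred.1 h0)]; exact hq.hitP_nonneg _ _
    | succ n ih =>
      intro h hh
      by_cases h0 : 0 ≤ level ℓ h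
      · rw [hitP_of_mem (B := {h | level ℓ h ∈ Set.Ico (0 : ℝ) 2}) ⟨h0, by linarith⟩]
        exact hq.hitP_le_one _ _
      · rw [hitP_succ_of_notMem (mt Set.mem_ofPred.1 h0),
          hitP_succ_of_notMem (fun h' => h0 h'.1)]
        exact hq.step_mono fun e => ih _ (by linarith [level_cons_le hℓ e h])
  exact key n h (by linarith)

/-- A recurrent walk returns to the slab from everywhere, and on each return it has a probability of
at least `κ ^ L` of visiting `L` sites of the slab in the next `L` steps. -/
theorem FreshRight.hitLim_slabSites (hd : 2 ≤ d) (hℓ : ∑ j, |ℓ j| = 1) {g q : Rule d}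
    (hg : Admissible κ ℓ g) (hrec : hitLim (localRule g) {h | level ℓ h < 0} [] = 1)
    (hq : FreshRight κ ℓ g q) (L : ℕ) (h : List (Dir d)) :
    hitLim q {h | L ≤ (slabSites ℓ h).card} h = 1 := by
  have hslab : ∀ h, 1 ≤ hitLim q {h | level ℓ h ∈ Set.Ico (0 : ℝ) 2} h := fun h => by
    have := hq.mul_hitLim_le (B := {h | level ℓ h < 0}) (c := 1) hq.hitLim_nonneg
      (fun h hh => by
        refine (hq.hitLim_le_level hℓ 0 h).ge.trans ?_
        exact hq.hitLim_nonneg_le_hitLim_Ico hℓ hh) (fun h _ => hq.step_hitLim_le h) h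
    rwa [hq.hitLim_neg_eq_one hℓ hg hrec, mul_one] at this
  refine le_antisymm (hq.hitLim_le_one h) (one_le_of_improves (pow_pos hq.κ_pos L)
    hq.hitLim_nonneg (fun m hm0 hm h => ?_) h)
  have hm1 := (hm h).trans (hq.hitLim_le_one h)
  have hc : 0 ≤ κ ^ L * (1 - m) + m :=
    add_nonneg (mul_nonneg (pow_nonneg hq.κ_pos.le L) (by linarith)) hm0
  have := hq.mul_hitLim_le (B := {h | level ℓ h ∈ Set.Ico (0 : ℝ) 2}) hq.hitLim_nonneg
    (fun h hh => by
      obtain ⟨t, htL, ht⟩ := exists_route_slabSites hd hℓ L hh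
      have := hq.route_le hq.step_hitLim_le hm (fun h hB => (hitLim_of_mem hB).ge) t h ht
      rwa [htL] at this) (fun h _ => hq.step_hitLim_le h) h
  exact (le_mul_of_one_le_right hc (hslab h)).trans this

/-! ### Uniformity over the behaviour on the left -/

theorem isCompact_freshRight (hκ : 0 < κ) (g : Rule d) :
    IsCompact {q : Rule d | FreshRight κ ℓ g q} := by
  have hbox : IsCompact (Set.univ.pi fun _ : List (Dir d) => Set.univ.pi fun _ : Dir d =>
      Set.Icc (0 : ℝ) 1) := isCompact_univ_pi fun _ => isCompact_univ_pi fun _ => isCompact_Icc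
  refine hbox.of_isClosed_subset ?_ fun q hq h _ e _ => ⟨hq.nonneg h e, ?_⟩
  · have : {q : Rule d | FreshRight κ ℓ g q} = {q | (∀ h e, κ ≤ q h e) ∧ (∀ h, ∑ e, q h e = 1) ∧
        (∀ h, 0 ≤ cookieDrift ℓ (q h)) ∧ ∀ h, 0 ≤ level ℓ h → q h = g (exits h (pos h))} :=
      Set.ext fun q => ⟨fun hq => ⟨hq.le, hq.sum_eq, hq.drift_nonneg, hq.eq_local⟩,
        fun ⟨h1, h2, h3, h4⟩ => ⟨⟨hκ, h1, h2, h3⟩, h4⟩⟩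
    rw [this]
    simp only [Set.ofPred_and, Set.ofPred_forall, cookieDrift]
    refine .inter (isClosed_iInter fun h => isClosed_iInter fun e => ?_)
      (.inter (isClosed_iInter fun h => ?_) (.inter (isClosed_iInter fun h => ?_)
        (isClosed_iInter fun h => isClosed_iInter fun _ => ?_)))
    · exact isClosed_le (by fun_prop) (by fun_prop)
    · exact isClosed_eq (by fun_prop) (by fun_prop)
    · exact isClosed_le (by fun_prop) (by fun_prop)
    · exact isClosed_eq (by fun_prop) (by fun_prop)
  · rw [← hq.sum_eq h]
    exact Finset.single_le_sum (fun e _ => hq.nonneg h e) (Finset.mem_univ e)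

/-- The number of steps in which a recurrent walk visits `L` sites of the slab can be bounded
uniformly in the rule on the left, because these rules form a compact set. -/
theorem exists_uniform_hitP (hd : 2 ≤ d) (hℓ : ∑ j, |ℓ j| = 1) {g : Rule d}
    (hg : Admissible κ ℓ g) (hrec : hitLim (localRule g) {h | level ℓ h < 0} [] = 1) (L : ℕ) :
    ∃ N, ∀ q, FreshRight κ ℓ g q → 1 / 2 ≤ hitP q {h | L ≤ (slabSites ℓ h).card} N [] := by
  obtain ⟨T, hT⟩ := (isCompact_freshRight (ℓ := ℓ) hg.κ_pos g).elim_finite_subcover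
    (fun n => {q : Rule d | 1 / 2 < hitP q {h | L ≤ (slabSites ℓ h).card} n []})
    (fun n => isOpen_lt continuous_const (continuous_hitP _ _ _)) fun q hq => by
      have h1 := hq.hitLim_slabSites hd hℓ hg hrec L []
      have h2 := hq.tendsto_hitP (B := {h | L ≤ (slabSites ℓ h).card}) []
      rw [h1] at h2
      obtain ⟨n, hn⟩ := (h2.eventually_const_lt (by norm_num : (1 / 2 : ℝ) < 1)).exists
      exact Set.mem_iUnion.2 ⟨n, hn⟩
  refine ⟨T.sup id, fun q hq => ?_⟩
  obtain ⟨n, hn, hq2⟩ := Set.mem_iUnion₂.1 (hT hq)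
  exact (le_of_lt hq2).trans (hq.monotone_hitP [] (Finset.le_sup (f := id) hn))

/-! ### Rewards collected before reaching a level -/

open Classical in
/-- The expected sum of the rewards `r` over the next `n` histories of the walk with rule `q` and
past `h`, where the walk is stopped as soon as its level is at least `k`. -/
noncomputable def reward (ℓ : Fin d → ℝ) (q : Rule d) (k : ℝ) (r : List (Dir d) → ℝ) :
    ℕ → List (Dir d) → ℝ
  | 0, _ => 0
  | n + 1, h => if level ℓ h < k then r h + step q (reward ℓ q k r n) h else 0

theorem reward_succ {q : Rule d} {k : ℝ} {h : List (Dir d)} (hk : level ℓ h < k)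
    (r : List (Dir d) → ℝ) (n : ℕ) :
    reward ℓ q k r (n + 1) h = r h + step q (reward ℓ q k r n) h := if_pos hk

theorem reward_of_le {q : Rule d} {k : ℝ} {h : List (Dir d)} (hk : k ≤ level ℓ h)
    (r : List (Dir d) → ℝ) (n : ℕ) : reward ℓ q k r n h = 0 := by
  cases n
  · rfl
  · exact if_neg (not_lt.2 hk)

theorem reward_const_mul (q : Rule d) (k c : ℝ) (r : List (Dir d) → ℝ) (n : ℕ)
    (h : List (Dir d)) :
    reward ℓ q k (fun h => c * r h) n h = c * reward ℓ q k r n h := by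
  induction n generalizing h with
  | zero => simp [reward]
  | succ n ih =>
    rcases lt_or_ge (level ℓ h) k with hk | hk
    · rw [reward_succ hk, reward_succ hk, mul_add, ← step_const_mul]
      simp only [step, ih]
    · simp only [reward_of_le hk, mul_zero]

theorem reward_sum {ι : Type*} (q : Rule d) (k : ℝ) (S : Finset ι) (r : ι → List (Dir d) → ℝ)
    (n : ℕ) (h : List (Dir d)) :
    reward ℓ q k (fun h => ∑ i ∈ S, r i h) n h = ∑ i ∈ S, reward ℓ q k (r i) n h := by
  induction n generalizing h with
  | zero => simp [reward]
  | succ n ih =>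
    rcases lt_or_ge (level ℓ h) k with hk | hk
    · simp only [reward_succ hk, Finset.sum_add_distrib, step, ih, Finset.mul_sum]
      rw [Finset.sum_comm]
    · simp [reward_of_le hk]

namespace Admissible

variable {q : Rule d} (hq : Admissible κ ℓ q) {k : ℝ} {r r' : List (Dir d) → ℝ}
include hq

theorem reward_nonneg (hr : ∀ h, 0 ≤ r h) (n : ℕ) (h : List (Dir d)) :
    0 ≤ reward ℓ q k r n h := by
  induction n generalizing h with
  | zero => exact le_rfl
  | succ n ih =>
    rcases lt_or_ge (level ℓ h) k with hk | hk
    · rw [reward_succ hk]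
      exact add_nonneg (hr h) (hq.le_step fun e => ih _)
    · exact (reward_of_le hk r _).ge

theorem reward_mono (hr : ∀ h, r h ≤ r' h) (n : ℕ) (h : List (Dir d)) :
    reward ℓ q k r n h ≤ reward ℓ q k r' n h := by
  induction n generalizing h with
  | zero => exact le_rfl
  | succ n ih =>
    rcases lt_or_ge (level ℓ h) k with hk | hk
    · rw [reward_succ hk, reward_succ hk]
      exact add_le_add (hr h) (hq.step_mono fun e => ih _)
    · rw [reward_of_le hk, reward_of_le hk]

theorem monotone_reward (hr : ∀ h, 0 ≤ r h) (h : List (Dir d)) :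
    Monotone fun n => reward ℓ q k r n h := by
  refine monotone_nat_of_le_succ fun n => ?_
  induction n generalizing h with
  | zero => exact hq.reward_nonneg hr _ _
  | succ n ih =>
    rcases lt_or_ge (level ℓ h) k with hk | hk
    · rw [reward_succ hk, reward_succ hk]
      exact add_le_add le_rfl (hq.step_mono fun e => ih _)
    · rw [reward_of_le hk, reward_of_le hk]

/-- The level minus the accumulated drift is a martingale, and the level stays below `k + 1` until
the walk is stopped. -/
theorem reward_drift_le (hℓ : ∑ j, |ℓ j| = 1) (n : ℕ) {h : List (Dir d)}
    (hh : level ℓ h ≤ k + 1) :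
    reward ℓ q k (fun h => cookieDrift ℓ (q h)) n h ≤ k + 1 - level ℓ h := by
  induction n generalizing h with
  | zero => simpa [reward] using hh
  | succ n ih =>
    rcases lt_or_ge (level ℓ h) k with hk | hk
    · rw [reward_succ hk]
      have h1 : step q (reward ℓ q k (fun h => cookieDrift ℓ (q h)) n) h ≤
          step q (fun h => k + 1 - level ℓ h) h :=
        hq.step_mono fun e => ih (by linarith [level_cons_le hℓ e h])
      rw [step_sub, hq.step_const, hq.step_level] at h1
      linarith
    · rw [reward_of_le hk]; linarith

/-- If each history in `A` can be extended by one step to a history in `A'` before the walk is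
stopped, then, by ellipticity, `A'` is visited at least `κ` times as often as `A`. -/
theorem mul_reward_indicator_le {A A' : Set (List (Dir d))}
    (hA : ∀ h ∈ A, ∃ e, e :: h ∈ A' ∧ level ℓ (e :: h) < k) (n : ℕ) (h : List (Dir d)) :
    κ * reward ℓ q k (A.indicator 1) n h ≤ reward ℓ q k (A'.indicator 1) (n + 1) h := by
  have h01 : ∀ (S : Set (List (Dir d))) h, (0 : ℝ) ≤ S.indicator 1 h := fun S =>
    Set.indicator_nonneg fun _ _ => zero_le_one
  have key : level ℓ h < k → κ * reward ℓ q k (A.indicator 1) n h + A'.indicator 1 h ≤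
      reward ℓ q k (A'.indicator 1) (n + 1) h := by
    induction n generalizing h with
    | zero =>
      intro hk
      rw [reward_succ hk]
      simp only [reward, mul_zero, zero_add]
      exact le_add_of_nonneg_right (hq.le_step fun e => le_rfl)
    | succ n ih =>
      intro hk
      rw [reward_succ hk, reward_succ hk (A'.indicator 1) (n + 1)]
      -- `D` dominates the indicator of `A'` until the walk is stopped, and vanishes afterwards.
      let D : List (Dir d) → ℝ := fun h => reward ℓ q k (A'.indicator 1) (n + 1) h -
        κ * reward ℓ q k (A.indicator 1) n h
      have hD0 : ∀ h, 0 ≤ D h := fun h => by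
        rcases lt_or_ge (level ℓ h) k with hk | hk
        · linarith [ih h hk, h01 A' h]
        · simp only [D, reward_of_le hk]; simp
      have hD : κ * A.indicator 1 h ≤ step q D h := by
        by_cases hhA : h ∈ A
        · obtain ⟨e, he, hek⟩ := hA h hhA
          have h1 := ih (e :: h) hek
          rw [Set.indicator_of_mem he, Pi.one_apply] at h1
          have h2 : 1 ≤ D (e :: h) := by simp only [D]; linarith
          have h3 := hq.add_le_step (F := D) (h := h) (fun e => hD0 _) e
          rw [Set.indicator_of_mem hhA, Pi.one_apply]
          nlinarith [hq.κ_pos]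
        · rw [Set.indicator_of_notMem hhA, mul_zero]
          exact hq.le_step fun e => hD0 _
      simp only [D] at hD
      rw [step_sub, step_const_mul] at hD
      linarith
  rcases lt_or_ge (level ℓ h) k with hk | hk
  · linarith [key hk, h01 A' h]
  · simp [reward_of_le hk]

end Admissible

/-! ### The drift bounds the number of visited sites -/

/-- The direction opposite to `e`. -/
def Dir.rev (e : Dir d) : Dir d := (e.1, -e.2)

theorem Dir.vec_rev (e : Dir d) : e.rev.vec = -e.vec := by
  simp [Dir.vec, Dir.rev, Pi.single_neg]

theorem Dir.vec_ne_zero (e : Dir d) : e.vec ≠ 0 := fun h => by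
  have := congrFun h e.1
  simp [Dir.vec] at this

/-- The histories that end, below the level `k`, at a site that has been left before exactly in
the directions `s`. -/
def exitSet (ℓ : Fin d → ℝ) (k : ℝ) (s : List (Dir d)) : Set (List (Dir d)) :=
  {h | exits h (pos h) = s ∧ level ℓ h < k}

/-- A walk can leave a new site in the directions `s`, returning immediately after each
exit. -/
theorem Admissible.pow_mul_reward_exitSet_le (hℓ : ∑ j, |ℓ j| = 1) {q : Rule d}
    (hq : Admissible κ ℓ q) (k : ℝ) (s : List (Dir d)) (n : ℕ) (h : List (Dir d)) :
    (κ ^ 2) ^ s.length * reward ℓ q (k + 1) ((exitSet ℓ k []).indicator 1) n h ≤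
      reward ℓ q (k + 1) ((exitSet ℓ k s).indicator 1) (n + 2 * s.length) h := by
  induction s with
  | nil => simp
  | cons e s ih =>
    have h1 := hq.mul_reward_indicator_le (k := k + 1) (A := exitSet ℓ k s)
      (A' := {h | ∃ h' ∈ exitSet ℓ k s, h = e :: h'})
      (fun h hh => ⟨e, ⟨h, hh, rfl⟩, by linarith [level_cons_le hℓ e h, hh.2]⟩)
      (n + 2 * s.length) h
    have h2 := hq.mul_reward_indicator_le (k := k + 1)
      (A := {h | ∃ h' ∈ exitSet ℓ k s, h = e :: h'}) (A' := exitSet ℓ k (e :: s))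
      (by
        rintro _ ⟨h, hh, rfl⟩
        have hp : pos (e.rev :: e :: h) = pos h := by simp [Dir.vec_rev]
        have hl : level ℓ (e.rev :: e :: h) = level ℓ h := by rw [level, hp]; rfl
        refine ⟨e.rev, ⟨?_, by rw [hl]; exact hh.2⟩, by rw [hl]; linarith [hh.2]⟩
        rw [hp]
        simp [exits, e.vec_ne_zero, hh.1]) (n + 2 * s.length + 1) h
    have h3 := mul_le_mul_of_nonneg_left ih (pow_nonneg hq.κ_pos.le 2)
    have h4 := mul_le_mul_of_nonneg_left h1 hq.κ_pos.le
    rw [List.length_cons, show n + 2 * (s.length + 1) = n + 2 * s.length + 1 + 1 by ring]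
    calc _ = κ ^ 2 * ((κ ^ 2) ^ s.length *
          reward ℓ q (k + 1) ((exitSet ℓ k []).indicator 1) n h) := by ring
      _ ≤ _ := by linarith

/-- If the local rule has a drift after the exits `s`, then the expected number of sites below
level `k` that are visited before the level `k + 1` is reached grows at most linearly in `k`. -/
theorem Admissible.mul_reward_new_le (hℓ : ∑ j, |ℓ j| = 1) {g : Rule d} (hg : Admissible κ ℓ g)
    {s : List (Dir d)} (hs : 0 < cookieDrift ℓ (g s)) {k : ℝ} (hk : -2 ≤ k) (n : ℕ) :
    cookieDrift ℓ (g s) * (κ ^ 2) ^ s.length *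
      reward ℓ (localRule g) (k + 1) ((exitSet ℓ k []).indicator 1) n [] ≤ k + 2 := by
  have h1 := mul_le_mul_of_nonneg_left
    (hg.toLocal.pow_mul_reward_exitSet_le hℓ k s n []) hs.le
  have h2 := hg.toLocal.reward_mono (k := k + 1)
    (r := fun h => cookieDrift ℓ (g s) * (exitSet ℓ k s).indicator 1 h)
    (r' := fun h => cookieDrift ℓ (localRule g h)) (fun h => by
      by_cases hh : h ∈ exitSet ℓ k s
      · rw [Set.indicator_of_mem hh, localRule, hh.1]; simp
      · rw [Set.indicator_of_notMem hh, mul_zero]; exact hg.drift_nonneg _)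
    (n + 2 * s.length) []
  have h3 := hg.toLocal.reward_drift_le (k := k + 1) hℓ (n + 2 * s.length) (h := [])
    (by rw [level_nil]; linarith)
  rw [reward_const_mul] at h2
  rw [level_nil] at h3
  rw [mul_assoc]
  linarith

/-! ### A recurrent walk visits too many sites -/

/-- The histories that end at a new site whose level is in `[j, j + 3)`. -/
def newIn (ℓ : Fin d → ℝ) (j : ℝ) : Set (List (Dir d)) :=
  {h | exits h (pos h) = [] ∧ level ℓ h ∈ Set.Ico j (j + 3)}

theorem card_slabSites_cons (e : Dir d) (h : List (Dir d)) :
    ((slabSites ℓ (e :: h)).card : ℝ) ≤ (slabSites ℓ h).card +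
      Set.indicator {h | exits h (pos h) = [] ∧ level ℓ h ∈ Set.Ico (0 : ℝ) 2} 1 h := by
  classical
  by_cases hh : exits h (pos h) = [] ∧ level ℓ h ∈ Set.Ico (0 : ℝ) 2
  · rw [Set.indicator_of_mem (s := {h | exits h (pos h) = [] ∧ level ℓ h ∈ Set.Ico (0 : ℝ) 2}) hh,
      Pi.one_apply]
    have : slabSites ℓ (e :: h) ⊆ insert (pos h) (slabSites ℓ h) := by
      intro x
      simp only [slabSites, sites, Finset.mem_filter, Finset.mem_insert]
      tauto
    exact_mod_cast (Finset.card_le_card this).trans (Finset.card_insert_le _ _)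
  · rw [Set.indicator_of_notMem
      (s := {h | exits h (pos h) = [] ∧ level ℓ h ∈ Set.Ico (0 : ℝ) 2}) hh, add_zero]
    refine Nat.cast_le.2 (Finset.card_le_card fun x => ?_)
    rw [exits_eq_nil_iff] at hh
    simp only [slabSites, sites, Finset.mem_filter, Finset.mem_insert]
    rintro ⟨rfl | hx, hl⟩
    · exact ⟨by_contra fun h' => hh ⟨h', hl⟩, hl⟩
    · exact ⟨hx, hl⟩

/-- The sites of the slab `[0, 2)` seen from a record at level `[j, j + 1)` are new sites of level
`[j, j + 3)`. -/
theorem IsRecord.mul_hitP_le_reward (hℓ : ∑ j, |ℓ j| = 1) {g : Rule d} (hg : Admissible κ ℓ g)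
    {h₀ : List (Dir d)} (h₀r : IsRecord ℓ h₀) {j k : ℝ} (hj : level ℓ h₀ ∈ Set.Ico j (j + 1))
    (L n : ℕ) (h : List (Dir d)) (hk : level ℓ (h ++ h₀) + n ≤ k) :
    L * hitP (shift (localRule g) h₀) {h | L ≤ (slabSites ℓ h).card} n h ≤
      (slabSites ℓ h).card + reward ℓ (localRule g) k ((newIn ℓ j).indicator 1) n (h ++ h₀) := by
  have h01 : ∀ h, (0 : ℝ) ≤ (newIn ℓ j).indicator 1 h :=
    Set.indicator_nonneg fun _ _ => zero_le_one
  have hmem : ∀ n h, L ≤ (slabSites ℓ h).card →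
      L * hitP (shift (localRule g) h₀) {h | L ≤ (slabSites ℓ h).card} n h ≤
      (slabSites ℓ h).card +
        reward ℓ (localRule g) k ((newIn ℓ j).indicator 1) n (h ++ h₀) := fun n h hL => by
    rw [hitP_of_mem (Set.mem_ofPred.2 hL), mul_one]
    exact le_add_of_le_of_nonneg (Nat.cast_le.2 hL) (hg.toLocal.reward_nonneg h01 _ _)
  induction n generalizing h with
  | zero =>
    by_cases hL : L ≤ (slabSites ℓ h).card
    · exact hmem _ _ hL
    · rw [hitP_zero_of_notMem (mt Set.mem_ofPred.1 hL), mul_zero]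
      exact add_nonneg (Nat.cast_nonneg _) le_rfl
  | succ n ih =>
    by_cases hL : L ≤ (slabSites ℓ h).card
    · exact hmem _ _ hL
    push_cast at hk
    have hn : (0 : ℝ) ≤ n := Nat.cast_nonneg n
    rw [hitP_succ_of_notMem (mt Set.mem_ofPred.1 hL), reward_succ (by linarith), ← step_const_mul]
    have hfr := h₀r.freshRight_shift hg
    have h1 := hfr.step_mono (h := h)
      (F := fun h => L * hitP (shift (localRule g) h₀) {h | L ≤ (slabSites ℓ h).card} n h)
      (F' := fun h => (slabSites ℓ h).card +
        reward ℓ (localRule g) k ((newIn ℓ j).indicator 1) n (h ++ h₀)) fun e => ih (e :: h)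
      (by rw [List.cons_append]; linarith [level_cons_le hℓ e (h ++ h₀)])
    have h2 : Set.indicator {h | exits h (pos h) = [] ∧ level ℓ h ∈ Set.Ico (0 : ℝ) 2} 1 h ≤
        (newIn ℓ j).indicator (1 : List (Dir d) → ℝ) (h ++ h₀) := by
      by_cases hh : exits h (pos h) = [] ∧ level ℓ h ∈ Set.Ico (0 : ℝ) 2
      · have : h ++ h₀ ∈ newIn ℓ j := by
          refine ⟨(h₀r.exits_append hh.2.1).trans hh.1, ?_⟩
          rw [level_append]
          exact ⟨by linarith [hj.1, hh.2.1], by linarith [hj.2, hh.2.2]⟩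
        rw [Set.indicator_of_mem this]
        exact Set.indicator_le_self' (fun _ _ => zero_le_one) _
      · rw [Set.indicator_of_notMem
          (s := {h | exits h (pos h) = [] ∧ level ℓ h ∈ Set.Ico (0 : ℝ) 2}) hh]
        exact h01 _
    rw [step_add] at h1
    have h3 := hfr.step_le (F := fun h => ((slabSites ℓ h).card : ℝ))
      (fun e => (card_slabSites_cons (ℓ := ℓ) e h).trans (add_le_add le_rfl h2))
    have h4 : step (shift (localRule g) h₀) (fun h =>
        reward ℓ (localRule g) k ((newIn ℓ j).indicator 1) n (h ++ h₀)) h =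
        step (localRule g) (reward ℓ (localRule g) k ((newIn ℓ j).indicator 1) n) (h ++ h₀) := rfl
    linarith

/-- If the rewards collected after first reaching the level `j` are worth `c`, then the rewards
collected from an earlier time on are worth `c` times the probability of reaching the level `j`. -/
theorem Admissible.mul_hitP_le_reward {q : Rule d} (hq : Admissible κ ℓ q) {j k c : ℝ}
    (hjk : j ≤ k) {r : List (Dir d) → ℝ} (hr : ∀ h, 0 ≤ r h) {N : ℕ}
    (hN : ∀ e h, Below ℓ j h → j ≤ level ℓ (e :: h) → c ≤ reward ℓ q k r N (e :: h)) (n : ℕ)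
    {h : List (Dir d)} (hh : Below ℓ j h) :
    c * hitP q {h | j ≤ level ℓ h} n h ≤ reward ℓ q k r (n + N) h := by
  have hlt := hh h List.suffix_rfl
  have hB : h ∉ {h | j ≤ level ℓ h} := not_le.2 hlt
  induction n generalizing h with
  | zero =>
    rw [hitP_zero_of_notMem hB, mul_zero]
    exact hq.reward_nonneg hr _ _
  | succ n ih =>
    rw [hitP_succ_of_notMem hB, ← step_const_mul,
      Nat.succ_add, reward_succ (hlt.trans_le hjk)]
    refine le_add_of_nonneg_of_le (hr h) (hq.step_mono fun e => ?_)
    rcases lt_or_ge (level ℓ (e :: h)) j with he | he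
    · exact ih (hh.cons he) he (not_le.2 he)
    · rw [hitP_of_mem (B := {h | j ≤ level ℓ h}) he, mul_one]
      exact (hN e h hh he).trans (hq.monotone_reward hr _ (Nat.le_add_left N n))

/-- A fresh walk with some drift has a positive probability of never going to the left of its
starting point. Otherwise it would visit many sites in each of the slabs `[3 i + 1, 3 i + 4)`. -/
theorem Admissible.hitLim_neg_lt_one (hd : 2 ≤ d) (hℓ : ∑ j, |ℓ j| = 1) {g : Rule d}
    (hg : Admissible κ ℓ g) {s : List (Dir d)} (hs : 0 < cookieDrift ℓ (g s)) :
    hitLim (localRule g) {h | level ℓ h < 0} [] < 1 := by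
  refine lt_of_le_of_ne (hg.toLocal.hitLim_le_one _) fun hrec => ?_
  have h01 : ∀ j h, (0 : ℝ) ≤ (newIn ℓ j).indicator 1 h := fun j =>
    Set.indicator_nonneg fun _ _ => zero_le_one
  set c := cookieDrift ℓ (g s) * (κ ^ 2) ^ s.length with hc
  have hc0 : 0 < c := mul_pos hs (pow_pos (pow_pos hg.κ_pos 2) _)
  obtain ⟨L, hL⟩ := exists_nat_ge (16 / c)
  rw [div_le_iff₀ hc0] at hL
  obtain ⟨N, hN⟩ := exists_uniform_hitP hd hℓ hg hrec L
  -- `J` slabs give `J * L / 4` sites, which exceeds the linear bound as soon as `J > N + 3`.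
  set J := N + 4 with hJ
  set k : ℝ := 3 * J + 1 + N with hk
  have hJ0 : (0 : ℝ) ≤ N := Nat.cast_nonneg N
  have hJN : (J : ℝ) = N + 4 := by rw [hJ]; push_cast; ring
  have hslab : ∀ i ∈ Finset.range J, ∃ n, (L : ℝ) / 4 ≤
      reward ℓ (localRule g) (k + 1) ((newIn ℓ (3 * i + 1)).indicator 1) n [] := by
    intro i hi
    have hiJ : (i : ℝ) + 1 ≤ J := by exact_mod_cast Finset.mem_range.1 hi
    have hi0 : (0 : ℝ) ≤ i := Nat.cast_nonneg i
    have hrecord : ∀ e h, Below ℓ (3 * i + 1) h → 3 * i + 1 ≤ level ℓ (e :: h) →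
        (L : ℝ) / 2 ≤ reward ℓ (localRule g) (k + 1)
          ((newIn ℓ (3 * i + 1)).indicator 1) N (e :: h) := by
      intro e h hb he
      have hr := hb.isRecord he
      have hlt : level ℓ (e :: h) < 3 * i + 1 + 1 := by
        linarith [level_cons_le hℓ e h, hb h List.suffix_rfl]
      have h1 := hr.mul_hitP_le_reward hℓ hg (k := k + 1) ⟨he, hlt⟩ L N []
        (by rw [List.nil_append]; linarith)
      have h2 := mul_le_mul_of_nonneg_left (hN _ (hr.freshRight_shift hg))
        (Nat.cast_nonneg (α := ℝ) L)
      simp only [slabSites, sites, Finset.filter_empty, Finset.card_empty, Nat.cast_zero,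
        zero_add, List.nil_append] at h1 h2
      linarith
    have hlim := hg.toLocal.tendsto_hitP (B := {h | (3 * i + 1 : ℝ) ≤ level ℓ h}) []
    rw [hg.toLocal.hitLim_le_level hℓ] at hlim
    obtain ⟨n, hn⟩ := (hlim.eventually_const_lt (by norm_num : (1 / 2 : ℝ) < 1)).exists
    refine ⟨n + N, le_trans ?_ (hg.toLocal.mul_hitP_le_reward (by linarith) (h01 _) hrecord n
      (below_of_length_lt hℓ (by simp; positivity)))⟩
    nlinarith [Nat.cast_nonneg (α := ℝ) L]
  choose! n hn using hslab
  set M := (Finset.range J).sup n with hM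
  have hlow : (J : ℝ) * (L / 4) ≤ ∑ i ∈ Finset.range J,
      reward ℓ (localRule g) (k + 1) ((newIn ℓ (3 * i + 1)).indicator 1) M [] := by
    have := Finset.card_nsmul_le_sum (Finset.range J) (fun i : ℕ => reward ℓ
      (localRule g) (k + 1) ((newIn ℓ (3 * i + 1)).indicator 1) M []) (L / 4)
      fun i hi => (hn i hi).trans (hg.toLocal.monotone_reward (h01 _) _ (Finset.le_sup hi))
    simpa using this
  rw [← reward_sum] at hlow
  have hdisj : ∀ h,
      ∑ i ∈ Finset.range J, (newIn ℓ (3 * i + 1)).indicator (1 : List (Dir d) → ℝ) h ≤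
      (exitSet ℓ k []).indicator 1 h := by
    intro h
    by_cases hex : ∃ i ∈ Finset.range J, h ∈ newIn ℓ (3 * i + 1)
    · obtain ⟨i, hi, hhi⟩ := hex
      have hiJ : (i : ℝ) + 1 ≤ J := by exact_mod_cast Finset.mem_range.1 hi
      rw [Finset.sum_eq_single i, Set.indicator_of_mem hhi,
        Set.indicator_of_mem (s := exitSet ℓ k []) ⟨hhi.1, by linarith [hhi.2.2]⟩]
      · intro i' _ hne
        refine Set.indicator_of_notMem (fun hi' => hne ?_) _
        have h1 : (i' : ℝ) < i + 1 := by linarith [hhi.2.2, hi'.2.1]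
        have h2 : (i : ℝ) < i' + 1 := by linarith [hhi.2.1, hi'.2.2]
        norm_cast at h1 h2
        omega
      · exact fun h' => absurd hi h'
    · push Not at hex
      rw [Finset.sum_eq_zero fun i hi => Set.indicator_of_notMem (hex i hi) _]
      exact Set.indicator_nonneg (fun _ _ => zero_le_one) _
  have hup := hg.mul_reward_new_le hℓ hs (k := k) (by linarith) M
  have hmono := hg.toLocal.reward_mono (k := k + 1) hdisj M []
  have h5 := (mul_le_mul_of_nonneg_left (hlow.trans hmono) hc0.le).trans hup
  have h6 : c * ((J : ℝ) * (L / 4)) = J * (L * c) / 4 := by ring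
  have h7 : (J : ℝ) * 16 ≤ J * (L * c) := mul_le_mul_of_nonneg_left hL (by linarith)
  linarith

/-! ### Transience of the averaged walk -/

/-- The expectation of `F` at the history `n` steps after `h`. -/
def expect (q : Rule d) : ℕ → (List (Dir d) → ℝ) → List (Dir d) → ℝ
  | 0, F => F
  | n + 1, F => step q (expect q n F)

namespace Admissible

variable {q : Rule d} (hq : Admissible κ ℓ q) (B : Set (List (Dir d)))
include hq

theorem expect_hitLim_antitone (h : List (Dir d)) :
    Antitone fun m => expect q m (hitLim q B) h := by
  refine antitone_nat_of_succ_le fun m => ?_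
  induction m generalizing h with
  | zero => exact hq.step_hitLim_le h
  | succ m ih => exact hq.step_mono fun e => ih _

theorem expect_hitLim_nonneg (m : ℕ) (h : List (Dir d)) : 0 ≤ expect q m (hitLim q B) h := by
  induction m generalizing h with
  | zero => exact hq.hitLim_nonneg h
  | succ m ih => exact hq.le_step fun e => ih _

end Admissible

/-- The probability that the walk with rule `q` and past `h` has infinitely many histories in
`B`. -/
noncomputable def hitInf (q : Rule d) (B : Set (List (Dir d))) (h : List (Dir d)) : ℝ :=
  ⨅ m, expect q m (hitLim q B) h

namespace Admissible

variable {q : Rule d} (hq : Admissible κ ℓ q) {B : Set (List (Dir d))}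
include hq

theorem tendsto_expect_hitLim (h : List (Dir d)) :
    Filter.Tendsto (fun m => expect q m (hitLim q B) h) Filter.atTop (nhds (hitInf q B h)) :=
  tendsto_atTop_ciInf (hq.expect_hitLim_antitone B h)
    ⟨0, by rintro _ ⟨m, rfl⟩; exact hq.expect_hitLim_nonneg B m h⟩

theorem hitInf_nonneg (h : List (Dir d)) : 0 ≤ hitInf q B h :=
  le_ciInf fun m => hq.expect_hitLim_nonneg B m h

theorem hitInf_le_hitLim (h : List (Dir d)) : hitInf q B h ≤ hitLim q B h :=
  (hq.expect_hitLim_antitone B h).le_of_tendsto (hq.tendsto_expect_hitLim h) 0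

theorem step_hitInf (h : List (Dir d)) : step q (hitInf q B) h = hitInf q B h := by
  refine tendsto_nhds_unique ?_
    ((hq.tendsto_expect_hitLim h).comp (Filter.tendsto_add_atTop_nat 1))
  exact tendsto_finsetSum _ fun e _ => (hq.tendsto_expect_hitLim (e :: h)).const_mul _

/-- To visit `B` infinitely often the walk first has to visit the larger set `C`, and then to
visit `B` infinitely often. -/
theorem hitInf_le_mul_hitLim {C : Set (List (Dir d))} (hBC : B ⊆ C) {c : ℝ}
    (hc : ∀ h, hitInf q B h ≤ c) (h : List (Dir d)) : hitInf q B h ≤ c * hitLim q C h := by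
  have key : ∀ n h, hitInf q B h ≤ c * hitP q C n h + (hitLim q C h - hitP q C n h) := by
    intro n
    induction n with
    | zero =>
      intro h
      by_cases hC : h ∈ C
      · rw [hitP_of_mem hC, hitLim_of_mem hC]; linarith [hc h]
      · rw [hitP_zero_of_notMem hC]
        linarith [hq.hitInf_le_hitLim (B := B) h, hq.hitLim_mono_set hBC h]
    | succ n ih =>
      intro h
      by_cases hC : h ∈ C
      · rw [hitP_of_mem hC, hitLim_of_mem hC]; linarith [hc h]
      · rw [hitP_succ_of_notMem hC, hq.hitLim_of_notMem hC, ← hq.step_hitInf, ← step_const_mul,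
          ← step_sub, ← step_add]
        exact hq.step_mono fun e => ih _
  have hlim := ((hq.tendsto_hitP (B := C) h).const_mul c).add
    ((hq.tendsto_hitP (B := C) h).const_sub (hitLim q C h))
  rw [sub_self, add_zero] at hlim
  exact ge_of_tendsto hlim (.of_forall fun n => key n h)

/-- The walk almost surely reaches a record above the level `k`, so that a harmonic function can be
bounded by its values at these records. -/
theorem hitInf_le_of_records (hℓ : ∑ j, |ℓ j| = 1) {k c c' : ℝ}
    (hc : ∀ h, hitInf q B h ≤ c)
    (hrec : ∀ e h, Below ℓ k h → k ≤ level ℓ (e :: h) → hitInf q B (e :: h) ≤ c')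
    {h : List (Dir d)} (hh : Below ℓ k h) : hitInf q B h ≤ c' := by
  have key : ∀ n h, Below ℓ k h → hitInf q B h ≤
      c + (c' - c) * hitP q {h | k ≤ level ℓ h} n h := by
    intro n
    induction n with
    | zero =>
      intro h hh
      have hB : h ∉ {h | k ≤ level ℓ h} := not_le.2 (hh h List.suffix_rfl)
      rw [hitP_zero_of_notMem hB, mul_zero, add_zero]
      exact hc h
    | succ n ih =>
      intro h hh
      have hB : h ∉ {h | k ≤ level ℓ h} := not_le.2 (hh h List.suffix_rfl)
      rw [hitP_succ_of_notMem hB, ← hq.step_hitInf,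
        ← step_const_mul, ← hq.step_const c h, ← step_add]
      refine hq.step_mono fun e => ?_
      rcases lt_or_ge (level ℓ (e :: h)) k with he | he
      · rw [hq.step_const]
        exact ih _ (hh.cons he)
      · rw [hitP_of_mem (B := {h | k ≤ level ℓ h}) he, hq.step_const]
        linarith [hrec e h hh he]
  have hlim := ((hq.tendsto_hitP (B := {h | k ≤ level ℓ h}) h).const_mul (c' - c)).const_add c
  rw [hq.hitLim_le_level hℓ, mul_one, add_sub_cancel] at hlim
  exact ge_of_tendsto hlim (.of_forall fun n => key n h hh)

end Admissible

/-- With a local rule that has some drift, the walk is almost surely below a given level only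
finitely often: from each record above this level it has a fixed positive probability of staying above. -/
theorem Admissible.hitInf_localRule_eq_zero (hd : 2 ≤ d) (hℓ : ∑ j, |ℓ j| = 1) {g : Rule d}
    (hg : Admissible κ ℓ g) {s : List (Dir d)} (hs : 0 < cookieDrift ℓ (g s)) (a : ℝ)
    (h : List (Dir d)) : hitInf (localRule g) {h | level ℓ h < a} h = 0 := by
  have hq := hg.toLocal
  set w := hitInf (localRule g) {h | level ℓ h < a} with hw
  set p := hitLim (localRule g) {h | level ℓ h < 0} [] with hp
  have hp1 : p < 1 := hg.hitLim_neg_lt_one hd hℓ hs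
  have hbdd : BddAbove (Set.range w) :=
    ⟨1, by rintro _ ⟨h, rfl⟩; exact (hq.hitInf_le_hitLim h).trans (hq.hitLim_le_one h)⟩
  have hle : ∀ h, w h ≤ ⨆ h, w h := fun h => le_ciSup hbdd h
  have himp : ∀ h, w h ≤ (⨆ h, w h) * p := fun h => by
    have h1 : a ≤ max a (h.length + 1) := le_max_left _ _
    refine hq.hitInf_le_of_records hℓ hle (k := max a (h.length + 1)) (fun e h' hb hk => ?_)
      (below_of_length_lt hℓ ((lt_add_one _).trans_le (le_max_right _ _)))
    have hr := hb.isRecord hk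
    have := hq.hitInf_le_mul_hitLim (C := {h | level ℓ h < level ℓ (e :: h')})
      (fun t ht => lt_of_lt_of_le ht (h1.trans hk)) hle (e :: h')
    rwa [hr.hitLim_lt_level hg] at this
  have h0 : 0 ≤ ⨆ h, w h := (hq.hitInf_nonneg h).trans (hle h)
  have h2 : (⨆ h, w h) ≤ (⨆ h, w h) * p := ciSup_le himp
  have h3 : (⨆ h, w h) ≤ 0 := by nlinarith
  exact le_antisymm ((hle h).trans h3) (hq.hitInf_nonneg h)

/-! ### Finite horizons -/

theorem expect_add (q : Rule d) (m n : ℕ) (F : List (Dir d) → ℝ) :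
    expect q (m + n) F = expect q m (expect q n F) := by
  induction m with
  | zero => rw [Nat.zero_add]; rfl
  | succ m ih => rw [Nat.succ_add]; simp only [expect, ih]

theorem expect_congr (q : Rule d) {n : ℕ} {F F' : List (Dir d) → ℝ} {h : List (Dir d)}
    (hF : ∀ t : List (Dir d), t.length = h.length + n → F t = F' t) :
    expect q n F h = expect q n F' h := by
  induction n generalizing h with
  | zero => exact hF h rfl
  | succ n ih =>
    exact Finset.sum_congr rfl fun e _ => by
      rw [ih fun t ht => hF t (by rw [ht, List.length_cons]; ring)]

theorem Admissible.expect_mono {q : Rule d} (hq : Admissible κ ℓ q) {F F' : List (Dir d) → ℝ}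
    (hF : ∀ h, F h ≤ F' h) (n : ℕ) (h : List (Dir d)) : expect q n F h ≤ expect q n F' h := by
  induction n generalizing h with
  | zero => exact hF h
  | succ n ih => exact hq.step_mono fun e => ih _

theorem Admissible.expect_mem_Icc {q : Rule d} (hq : Admissible κ ℓ q) {F : List (Dir d) → ℝ}
    (hF : ∀ h, F h ∈ Set.Icc (0 : ℝ) 1) (n : ℕ) (h : List (Dir d)) :
    expect q n F h ∈ Set.Icc (0 : ℝ) 1 := by
  induction n generalizing h with
  | zero => exact hF h
  | succ n ih => exact ⟨hq.le_step fun e => (ih _).1, hq.step_le fun e => (ih _).2⟩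

/-- The histories that were in `B` at some time not before `m`. -/
def lateHit (B : Set (List (Dir d))) (m : ℕ) : Set (List (Dir d)) :=
  {h | ∃ t, t <:+ h ∧ m ≤ t.length ∧ t ∈ B}

theorem mem_lateHit_cons {B : Set (List (Dir d))} {m : ℕ} {h : List (Dir d)} (e : Dir d)
    (hh : h ∈ lateHit B m) : e :: h ∈ lateHit B m := by
  obtain ⟨t, ht, h2⟩ := hh
  exact ⟨t, ht.trans (List.suffix_cons _ _), h2⟩

theorem indicator_one_mem_Icc (B : Set (List (Dir d))) (h : List (Dir d)) :
    B.indicator (1 : List (Dir d) → ℝ) h ∈ Set.Icc (0 : ℝ) 1 :=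
  ⟨Set.indicator_nonneg (fun _ _ => zero_le_one) _,
    Set.indicator_le_self' (fun _ _ => zero_le_one) _⟩

namespace Admissible

variable {q : Rule d} (hq : Admissible κ ℓ q) (B : Set (List (Dir d)))
include hq

theorem expect_lateHit_of_mem {m : ℕ} (n : ℕ) {h : List (Dir d)} (hh : h ∈ lateHit B m) :
    expect q n ((lateHit B m).indicator 1) h = 1 := by
  induction n generalizing h with
  | zero => exact Set.indicator_of_mem hh _
  | succ n ih =>
    rw [expect, step]
    simp only [ih (mem_lateHit_cons _ hh), mul_one, hq.sum_eq]

/-- Hitting probabilities as expectations of a function that does not depend on the rule. -/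
theorem expect_lateHit_eq_hitP (n : ℕ) (h : List (Dir d)) :
    expect q n ((lateHit B h.length).indicator 1) h = hitP q B n h := by
  have key : ∀ m n h, m ≤ h.length → h ∉ lateHit B m →
      expect q n ((lateHit B m).indicator 1) h = hitP q B n h := by
    intro m n
    induction n with
    | zero =>
      intro h hm hh
      rw [hitP_zero_of_notMem fun hB => hh ⟨h, List.suffix_rfl, hm, hB⟩]
      exact Set.indicator_of_notMem hh _
    | succ n ih =>
      intro h hm hh
      rw [hitP_succ_of_notMem fun hB => hh ⟨h, List.suffix_rfl, hm, hB⟩, expect]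
      refine Finset.sum_congr rfl fun e _ => ?_
      by_cases he : e :: h ∈ lateHit B m
      · rw [hq.expect_lateHit_of_mem B n he]
        obtain ⟨t, ht, hmt, htB⟩ := he
        rcases List.suffix_cons_iff.1 ht with rfl | ht
        · rw [hitP_of_mem htB]
        · exact absurd ⟨t, ht, hmt, htB⟩ hh
      · rw [ih _ (hm.trans (List.suffix_cons e h).length_le) he]
  by_cases hB : h ∈ B
  · rw [hitP_of_mem hB, hq.expect_lateHit_of_mem B n ⟨h, List.suffix_rfl, le_rfl, hB⟩]
  · refine key _ _ _ le_rfl fun ⟨t, ht, hmt, htB⟩ => hB ?_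
    rwa [ht.eq_of_length_le hmt] at htB

theorem expect_lateHit_le (m n : ℕ) :
    expect q (m + n) ((lateHit B m).indicator 1) [] ≤ expect q m (hitLim q B) [] := by
  rw [expect_add, expect_congr q (F' := hitP q B n)]
  · exact hq.expect_mono (fun h => hq.hitP_le_hitLim n h) m []
  · intro t ht
    rw [List.length_nil, zero_add] at ht
    rw [← ht, hq.expect_lateHit_eq_hitP]

end Admissible

/-! ### Averaging over the environment -/

/-- The rule of the excited random walk in the environment `ω`. -/
def envRule (ω : Env d κ ℓ) : Rule d := fun h e => prob ω (pos h) (exits h (pos h)).length e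

/-- The probability that the walk with rule `q` takes the steps `h`. -/
def weight (q : Rule d) : List (Dir d) → ℝ
  | [] => 1
  | e :: h => weight q h * q h e

/-- The probability that the successive jumps from a site with the cookies `c` are `s`. -/
def cookieWeight (c : ℕ → Dir d → ℝ) : List (Dir d) → ℝ
  | [] => 1
  | e :: s => cookieWeight c s * c s.length e

/-- If the probabilities of a step depend only on the site and on the previous exits from it, then
the probability of a path is a product over the sites. -/
theorem weight_eq_prod {q : Rule d} {c : Site d → List (Dir d) → ℝ}
    (hnil : ∀ x, c x [] = 1)
    (hcons : ∀ h e, c (pos h) (e :: exits h (pos h)) = c (pos h) (exits h (pos h)) * q h e)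
    (h : List (Dir d)) {S : Finset (Site d)} (hS : sites h ⊆ S) :
    weight q h = ∏ x ∈ S, c x (exits h x) := by
  induction h with
  | nil => simp [weight, exits, hnil]
  | cons e h ih =>
    rw [sites, Finset.insert_subset_iff] at hS
    have : ∀ x ∈ S, c x (exits (e :: h) x) = c x (exits h x) * if pos h = x then q h e else 1 := by
      intro x _
      by_cases hx : pos h = x
      · subst hx; simp [exits, hcons]
      · simp [exits, hx]
    rw [weight, ih hS.2, Finset.prod_congr rfl this, Finset.prod_mul_distrib, Finset.prod_ite_eq,
      if_pos hS.1]

section Cookies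

variable (hκ : 0 < κ) (c : CookieStack d κ ℓ)
include hκ

theorem cookie_nonneg (i : ℕ) (e : Dir d) : 0 ≤ (c : ℕ → Dir d → ℝ) i e :=
  hκ.le.trans (c.2.1 i e).1

theorem pow_le_cookieWeight (s : List (Dir d)) : κ ^ s.length ≤ cookieWeight c s := by
  induction s with
  | nil => simp [cookieWeight]
  | cons e s ih =>
    rw [List.length_cons, pow_succ, cookieWeight]
    exact mul_le_mul ih (c.2.1 _ e).1 hκ.le ((pow_nonneg hκ.le _).trans ih)

theorem cookieWeight_pos (s : List (Dir d)) : 0 < cookieWeight c s :=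
  (pow_pos hκ _).trans_le (pow_le_cookieWeight hκ c s)

theorem cookieWeight_le_one (s : List (Dir d)) : cookieWeight c s ≤ 1 := by
  induction s with
  | nil => simp [cookieWeight]
  | cons e s ih =>
    exact mul_le_one₀ ih (cookie_nonneg hκ c _ e) ((c.2.1 _ e).2.trans (by linarith))

end Cookies

theorem measurable_cookie (i : ℕ) (e : Dir d) :
    Measurable fun c : CookieStack d κ ℓ => (c : ℕ → Dir d → ℝ) i e :=
  (measurable_pi_apply e).comp ((measurable_pi_apply i).comp measurable_subtype_coe)

theorem measurable_cookieWeight (s : List (Dir d)) :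
    Measurable fun c : CookieStack d κ ℓ => cookieWeight c s := by
  induction s with
  | nil => exact measurable_const
  | cons e s ih => exact ih.mul (measurable_cookie _ e)

variable (μ : Measure (Env d κ ℓ))

/-- The averaged probability that the successive jumps from a site are `s`. -/
noncomputable def meanWeight (s : List (Dir d)) : ℝ := ∫ ω, cookieWeight (ω 0) s ∂μ

/-- The conditional probability, averaged over the environment, of jumping in direction `e` from a
site that was left in the directions `s` before. -/
noncomputable def meanRule : Rule d := fun s e => meanWeight μ (e :: s) / meanWeight μ s

section Average

variable {μ} [IsProbabilityMeasure μ] (hκ : 0 < κ)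
include hκ

theorem integrable_cookieWeight (x : Site d) (s : List (Dir d)) :
    Integrable (fun ω : Env d κ ℓ => cookieWeight (ω x) s) μ :=
  .of_bound ((measurable_cookieWeight s).comp (measurable_pi_apply x)).aestronglyMeasurable 1
    (.of_forall fun ω => by
      rw [Real.norm_of_nonneg (cookieWeight_pos hκ _ s).le]
      exact cookieWeight_le_one hκ _ s)

theorem meanWeight_pos (s : List (Dir d)) : 0 < meanWeight μ s := by
  refine (pow_pos hκ s.length).trans_le ?_
  have := integral_mono (μ := μ) (integrable_const (κ ^ s.length))
    (integrable_cookieWeight hκ 0 s) fun ω => pow_le_cookieWeight hκ (ω 0) s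
  rwa [integral_const, probReal_univ, one_smul] at this

theorem meanRule_mul (s : List (Dir d)) (e : Dir d) :
    meanWeight μ s * meanRule μ s e = meanWeight μ (e :: s) :=
  mul_div_cancel₀ _ (meanWeight_pos hκ s).ne'

theorem integrable_cookieWeight_mul_drift (s : List (Dir d)) :
    Integrable (fun ω : Env d κ ℓ =>
      cookieWeight (ω 0) s * cookieDrift ℓ (prob ω 0 s.length)) μ := by
  have : (fun ω : Env d κ ℓ => cookieWeight (ω 0) s * cookieDrift ℓ (prob ω 0 s.length)) =
      fun ω => ∑ e : Dir d, cookieWeight (ω 0) (e :: s) * proj ℓ e.vec := by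
    funext ω
    simp only [cookieDrift, Finset.mul_sum, cookieWeight, prob, mul_assoc]
  rw [this]
  exact integrable_finsetSum _ fun e _ => (integrable_cookieWeight hκ 0 _).mul_const _

theorem meanWeight_mul_drift (s : List (Dir d)) :
    meanWeight μ s * cookieDrift ℓ (meanRule μ s) =
      ∫ ω, cookieWeight (ω 0) s * cookieDrift ℓ (prob ω 0 s.length) ∂μ := by
  simp only [cookieDrift, Finset.mul_sum, ← mul_assoc, meanRule_mul hκ]
  rw [integral_finsetSum _ fun e _ => by
    exact (integrable_cookieWeight hκ 0 (e :: s)).mul_const (proj ℓ e.vec)]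
  exact Finset.sum_congr rfl fun e _ => by rw [integral_mul_const]; rfl

theorem admissible_meanRule : Admissible κ ℓ (meanRule μ) := by
  refine ⟨hκ, fun s e => ?_, fun s => ?_, fun s => ?_⟩
  · rw [meanRule, le_div_iff₀ (meanWeight_pos hκ s), mul_comm, meanWeight, ← integral_mul_const]
    exact integral_mono ((integrable_cookieWeight hκ 0 s).mul_const κ)
      (integrable_cookieWeight hκ 0 (e :: s)) fun ω =>
        mul_le_mul_of_nonneg_left ((ω 0).2.1 _ e).1 (cookieWeight_pos hκ _ s).le
  · simp only [meanRule, ← Finset.sum_div]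
    rw [div_eq_one_iff_eq (meanWeight_pos hκ s).ne']
    simp only [meanWeight]
    rw [← integral_finsetSum _ fun e _ => integrable_cookieWeight hκ 0 (e :: s)]
    refine integral_congr_ae (.of_forall fun ω => ?_)
    simp only [cookieWeight, ← Finset.mul_sum]
    rw [(ω 0).2.2.1, mul_one]
  · refine nonneg_of_mul_nonneg_right ?_ (meanWeight_pos (μ := μ) hκ s)
    rw [meanWeight_mul_drift hκ]
    exact integral_nonneg fun ω => mul_nonneg (cookieWeight_pos hκ _ s).le ((ω 0).2.2.2 _)

/-- If the mean total drift at the origin is positive, then so is the drift of the averaged walk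
after some exits. -/
theorem exists_drift_meanRule_pos (e₀ : Dir d) (hδ : 0 < ∫⁻ ω, totalDrift ω 0 ∂μ) :
    ∃ s, 0 < cookieDrift ℓ (meanRule μ s) := by
  by_contra! hs
  have h0 : ∀ i : ℕ, ∀ᵐ ω ∂μ, cookieDrift ℓ (prob ω 0 i) = 0 := by
    intro i
    have hlen : (List.replicate i e₀).length = i := List.length_replicate
    have h1 := meanWeight_mul_drift (μ := μ) hκ (List.replicate i e₀)
    rw [le_antisymm (hs _) ((admissible_meanRule hκ).drift_nonneg _), mul_zero, hlen] at h1
    have hint := integrable_cookieWeight_mul_drift (μ := μ) hκ (List.replicate i e₀)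
    rw [hlen] at hint
    have h2 := (integral_eq_zero_iff_of_nonneg (fun ω : Env d κ ℓ => mul_nonneg
      (cookieWeight_pos hκ (ω 0) (List.replicate i e₀)).le ((ω 0).2.2.2 i)) hint).1 h1.symm
    filter_upwards [h2] with ω hω
    exact (mul_eq_zero.1 hω).resolve_left (cookieWeight_pos hκ _ _).ne'
  refine hδ.ne' ?_
  rw [lintegral_congr_ae (g := fun _ => 0), lintegral_zero]
  filter_upwards [ae_all_iff.2 h0] with ω hω
  simp [totalDrift, hω]

/-- Averaged over an i.i.d. environment, the probability of a path is that of the averaged walk. -/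
theorem integral_weight (hiid : IsIID μ) (h : List (Dir d)) :
    Integrable (fun ω => weight (envRule ω) h) μ ∧
      ∫ ω, weight (envRule ω) h ∂μ = weight (localRule (meanRule μ)) h := by
  have h1 : ∀ ω : Env d κ ℓ,
      weight (envRule ω) h = ∏ x : sites h, cookieWeight (ω x) (exits h x) := fun ω => by
    rw [weight_eq_prod (q := envRule ω) (c := fun x => cookieWeight (ω x)) (fun x => rfl)
      (fun h e => rfl) h (Finset.Subset.refl _)]
    exact (Finset.prod_coe_sort (sites h) fun x => cookieWeight (ω x) (exits h x)).symm
  have hmean : ∀ x s, ∫ ω, cookieWeight (ω x) s ∂μ = meanWeight μ s := fun x s =>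
    ((hiid.2 x).comp (measurable_cookieWeight s)).integral_eq
  have hmeas : ∀ (x : Site d) (s : List (Dir d)),
      Measurable fun ω : Env d κ ℓ => cookieWeight (ω x) s := fun x s =>
    (measurable_cookieWeight s).comp (measurable_pi_apply x)
  simp only [h1]
  constructor
  · refine .of_bound (Finset.measurable_prod _ fun x _ => hmeas _ _).aestronglyMeasurable 1
      (.of_forall fun ω => ?_)
    rw [Real.norm_of_nonneg (Finset.prod_nonneg fun x _ => (cookieWeight_pos hκ _ _).le)]
    exact Finset.prod_le_one (fun x _ => (cookieWeight_pos hκ _ _).le)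
      fun x _ => cookieWeight_le_one hκ _ _
  · have hind : iIndepFun (fun (x : sites h) (ω : Env d κ ℓ) => cookieWeight (ω x) (exits h x)) μ :=
      (hiid.1.precomp (g := fun x : sites h => (x : Site d)) Subtype.val_injective).comp
        (fun x (c : CookieStack d κ ℓ) => cookieWeight c.1 (exits h x))
        fun x => measurable_cookieWeight _
    rw [hind.integral_fun_prod_eq_prod_integral fun x => (hmeas _ _).aestronglyMeasurable]
    simp only [hmean]
    rw [weight_eq_prod (q := localRule (meanRule μ)) (c := fun _ => meanWeight μ)
      (fun x => by simp [meanWeight, cookieWeight])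
      (fun h e => (meanRule_mul hκ _ e).symm) h (Finset.Subset.refl _)]
    exact Finset.prod_coe_sort (sites h) fun x => meanWeight μ (exits h x)

/-- The averaged walk reproduces the averages of all expectations over finitely many steps. -/
theorem integral_weight_mul_expect (hiid : IsIID μ) (F : List (Dir d) → ℝ) (n : ℕ)
    (h : List (Dir d)) :
    Integrable (fun ω => weight (envRule ω) h * expect (envRule ω) n F h) μ ∧
      ∫ ω, weight (envRule ω) h * expect (envRule ω) n F h ∂μ =
        weight (localRule (meanRule μ)) h * expect (localRule (meanRule μ)) n F h := by
  induction n generalizing h with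
  | zero =>
    have h1 := integral_weight hκ hiid h
    exact ⟨h1.1.mul_const _, by simp only [expect]; rw [integral_mul_const, h1.2]⟩
  | succ n ih =>
    have h1 : ∀ q : Rule d, weight q h * expect q (n + 1) F h =
        ∑ e, weight q (e :: h) * expect q n F (e :: h) := fun q => by
      simp only [expect, step, Finset.mul_sum, weight, mul_assoc]
    simp only [h1]
    refine ⟨integrable_finsetSum _ fun e _ => (ih _).1, ?_⟩
    rw [integral_finsetSum _ fun e _ => (ih _).1]
    exact Finset.sum_congr rfl fun e _ => (ih _).2

end Average

theorem admissible_envRule (hκ : 0 < κ) (ω : Env d κ ℓ) : Admissible κ ℓ (envRule ω) :=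
  ⟨hκ, fun h e => ((ω (pos h)).2.1 _ e).1, fun h => (ω (pos h)).2.2.1 _,
    fun h => (ω (pos h)).2.2.2 _⟩

/-- For almost every environment the probability of a visit to `B` after time `m` tends to `0`, if
the averaged walk is in `B` only finitely often. -/
theorem ae_iInf_iSup_expect_lateHit [IsProbabilityMeasure μ] (hκ : 0 < κ) (hiid : IsIID μ)
    {B : Set (List (Dir d))} (hB : hitInf (localRule (meanRule μ)) B [] = 0) :
    ∀ᵐ ω ∂μ, ⨅ m, ⨆ n, ENNReal.ofReal
      (expect (envRule ω) (m + n) ((lateHit B m).indicator 1) []) = 0 := by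
  have hq := (admissible_meanRule (μ := μ) hκ).toLocal
  have hint : ∀ m n, Integrable
      (fun ω => expect (envRule ω) (m + n) ((lateHit B m).indicator 1) []) μ ∧
      ∫ ω, expect (envRule ω) (m + n) ((lateHit B m).indicator 1) [] ∂μ =
        expect (localRule (meanRule μ)) (m + n) ((lateHit B m).indicator 1) [] := fun m n => by
    simpa [weight] using integral_weight_mul_expect hκ hiid ((lateHit B m).indicator 1) (m + n) []
  have hmeas : ∀ m n, AEMeasurable (fun ω => ENNReal.ofReal
      (expect (envRule ω) (m + n) ((lateHit B m).indicator 1) [])) μ := fun m n =>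
    (hint m n).1.1.aemeasurable.ennreal_ofReal
  have hmono : ∀ m (ω : Env d κ ℓ), Monotone fun n => ENNReal.ofReal
      (expect (envRule ω) (m + n) ((lateHit B m).indicator 1) []) := fun m ω =>
    monotone_nat_of_le_succ fun n => ENNReal.ofReal_le_ofReal <| by
      rw [← add_assoc, expect_add _ (m + n) 1]
      refine (admissible_envRule hκ ω).expect_mono (fun h => ?_) _ _
      by_cases hh : h ∈ lateHit B m
      · rw [(admissible_envRule hκ ω).expect_lateHit_of_mem B 1 hh]
        exact (indicator_one_mem_Icc _ _).2
      · rw [Set.indicator_of_notMem hh]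
        exact ((admissible_envRule hκ ω).expect_mem_Icc (indicator_one_mem_Icc _) _ _).1
  have hle : ∀ m, ∫⁻ ω, ⨅ m, ⨆ n, ENNReal.ofReal
      (expect (envRule ω) (m + n) ((lateHit B m).indicator 1) []) ∂μ ≤
      ENNReal.ofReal
        (expect (localRule (meanRule μ)) m (hitLim (localRule (meanRule μ)) B) []) := by
    intro m
    refine (lintegral_mono fun ω => iInf_le _ m).trans ?_
    rw [lintegral_iSup' (hmeas m) (.of_forall (hmono m))]
    refine iSup_le fun n => ?_
    rw [← ofReal_integral_eq_lintegral_ofReal (hint m n).1 (.of_forall fun ω =>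
      ((admissible_envRule hκ ω).expect_mem_Icc (indicator_one_mem_Icc _) _ _).1), (hint m n).2]
    exact ENNReal.ofReal_le_ofReal (hq.expect_lateHit_le B m n)
  have hlim := ENNReal.tendsto_ofReal (hq.tendsto_expect_hitLim (B := B) [])
  rw [hB, ENNReal.ofReal_zero] at hlim
  exact (lintegral_eq_zero_iff' (.iInf fun m => .iSup fun n => hmeas m n)).1
    (le_antisymm (ge_of_tendsto hlim (.of_forall hle)) zero_le)

/-! ### The history of an excited random walk -/

/-- The first `n` steps of the path `p`, the latest step first. The value is meaningful only if `p`
is a nearest-neighbour path. -/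
noncomputable def hist [NeZero d] (p : ℕ → Site d) : ℕ → List (Dir d)
  | 0 => []
  | n + 1 => Function.invFun Dir.vec (p (n + 1) - p n) :: hist p n

section Path

variable [NeZero d]

theorem length_hist (p : ℕ → Site d) (n : ℕ) : (hist p n).length = n := by
  induction n with
  | zero => rfl
  | succ n ih => simp [hist, ih]

theorem hist_congr {p p' : ℕ → Site d} {n : ℕ} (hp : ∀ m ≤ n, p m = p' m) :
    hist p n = hist p' n := by
  induction n with
  | zero => rfl
  | succ n ih =>
    rw [hist, hist, ih fun m hm => hp m (hm.trans n.le_succ), hp _ le_rfl, hp n n.le_succ]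

theorem hist_succ {p : ℕ → Site d} {n : ℕ} {e : Dir d} (he : p (n + 1) = p n + e.vec) :
    hist p (n + 1) = e :: hist p n := by
  rw [hist, he, add_sub_cancel_left, Function.leftInverse_invFun vec_injective e]

theorem hist_suffix {p : ℕ → Site d} {m n : ℕ} (hmn : m ≤ n) : hist p m <:+ hist p n := by
  induction n, hmn using Nat.le_induction with
  | base => exact List.suffix_rfl
  | succ n _ ih => exact ih.trans (List.suffix_cons _ _)

variable {p : ℕ → Site d} (h0 : p 0 = 0) (hstep : ∀ n, ∃ e : Dir d, p (n + 1) = p n + e.vec)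
include h0 hstep

theorem pos_hist (n : ℕ) : pos (hist p n) = p n := by
  induction n with
  | zero => exact h0.symm
  | succ n ih =>
    obtain ⟨e, he⟩ := hstep n
    rw [hist_succ he, pos_cons, ih, he]

theorem length_exits_hist (n : ℕ) (x : Site d) :
    (exits (hist p n) x).length = ((Finset.range n).filter fun m => p m = x).card := by
  induction n with
  | zero => rfl
  | succ n ih =>
    obtain ⟨e, he⟩ := hstep n
    rw [hist_succ he, exits, pos_hist h0 hstep, Finset.range_add_one, Finset.filter_insert]
    split_ifs with hx
    · rw [List.length_cons, ih, Finset.card_insert_of_notMem (by simp)]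
    · exact ih

theorem envRule_hist (ω : Env d κ ℓ) (n : ℕ) (e : Dir d) :
    envRule ω (hist p n) e = prob ω (p n) (priorVisits p n) e := by
  rw [envRule, pos_hist h0 hstep, length_exits_hist h0 hstep]
  rfl

end Path

/-- A function of the first `n` steps is measurable for the history. -/
theorem stronglyMeasurable_hist [NeZero d] {Ω' : Type*} (X : ℕ → Ω' → Site d) (n : ℕ)
    (G : List (Dir d) → ℝ) :
    StronglyMeasurable[history X n] fun w => G (hist (fun m => X m w) n) := by
  let Φ : (Finset.Iic n → Site d) → ℝ := fun r =>
    G (hist (fun m => if hm : m ∈ Finset.Iic n then r ⟨m, hm⟩ else 0) n)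
  have hΦ : Measurable Φ := measurable_of_countable Φ
  have h : (fun w => G (hist (fun m => X m w) n)) =
      Φ ∘ fun w (m : Finset.Iic n) => X m w := by
    funext w
    simp only [Φ, Function.comp]
    congr 1
    exact hist_congr fun m hm => by simp [hm]
  rw [h]
  exact (hΦ.comp (comap_measurable _)).stronglyMeasurable

namespace IsERW

variable {Ω' : Type*} [MeasurableSpace Ω'] {P : Measure Ω'} {X : ℕ → Ω' → Site d}
  {ω : Env d κ ℓ}

theorem history_le {x : Site d} (hX : IsERW ω x P X) (n : ℕ) :
    history X n ≤ (inferInstance : MeasurableSpace Ω') :=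
  measurable_iff_comap_le.1 (measurable_pi_lambda _ fun m => hX.measurable m)

theorem measurableSet_step {x : Site d} (hX : IsERW ω x P X) (n : ℕ) (e : Dir d) :
    MeasurableSet {w | X (n + 1) w = X n w + e.vec} :=
  measurableSet_eq_fun (hX.measurable _) ((hX.measurable n).add_const _)

/-- The steps of the walk are unit vectors, as the probabilities of these steps add up to `1`. -/
theorem ae_exists_step [IsProbabilityMeasure P] {x : Site d} (hX : IsERW ω x P X) :
    ∀ᵐ w ∂P, ∀ n, ∃ e : Dir d, X (n + 1) w = X n w + e.vec := by
  refine ae_all_iff.2 fun n => ?_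
  have hm := hX.history_le n
  have h1 : ∀ e : Dir d, Integrable
      (fun w => prob ω (X n w) (priorVisits (fun m => X m w) n) e) P := fun e =>
    integrable_condExp.congr (hX.step n e)
  have h2 : ∀ e : Dir d, P.real {w | X (n + 1) w = X n w + e.vec} =
      ∫ w, prob ω (X n w) (priorVisits (fun m => X m w) n) e ∂P := fun e => by
    rw [← integral_congr_ae (hX.step n e), integral_condExp hm,
      integral_indicator_const _ (hX.measurableSet_step n e), smul_eq_mul, mul_one]
  have h3 : P.real
      (⋃ e ∈ (Finset.univ : Finset (Dir d)), {w | X (n + 1) w = X n w + e.vec}) = 1 := by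
    rw [measureReal_biUnion_finset]
    · simp only [h2]
      rw [← integral_finsetSum _ fun e _ => h1 e]
      have : ∀ w, ∑ e, prob ω (X n w) (priorVisits (fun m => X m w) n) e = 1 := fun w =>
        (ω (X n w)).2.2.1 _
      simp [this]
    · intro e _ e' _ hne
      refine Set.disjoint_left.2 fun w hw hw' => hne (vec_injective ?_)
      exact add_left_cancel ((Set.mem_ofPred.1 hw).symm.trans hw')
    · exact fun e _ => hX.measurableSet_step n e
  have h4 : MeasurableSet
      (⋃ e ∈ (Finset.univ : Finset (Dir d)), {w | X (n + 1) w = X n w + e.vec}) :=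
    Finset.measurableSet_biUnion _ fun e _ => hX.measurableSet_step n e
  have h5 : P (⋃ e ∈ (Finset.univ : Finset (Dir d)), {w | X (n + 1) w = X n w + e.vec}) = 1 := by
    rwa [measureReal_def, ENNReal.toReal_eq_one_iff] at h3
  filter_upwards [(mem_ae_iff_prob_eq_one h4).2 h5] with w hw
  simpa using hw

variable [IsProbabilityMeasure P] [NeZero d] (hX : IsERW ω 0 P X)
include hX

/-- The defining property of the walk, in integrated form. -/
theorem integral_step_hist {G : List (Dir d) → ℝ} (hG : ∀ h, G h ∈ Set.Icc (0 : ℝ) 1) (n : ℕ) :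
    ∫ w, ExcitedWalk.step (envRule ω) G (hist (fun m => X m w) n) ∂P =
      ∫ w, G (hist (fun m => X m w) (n + 1)) ∂P := by
  have hm := hX.history_le n
  let S : Dir d → Set Ω' := fun e => {w | X (n + 1) w = X n w + e.vec}
  let Z : Dir d → Ω' → ℝ := fun e w => G (e :: hist (fun m => X m w) n)
  have hS : ∀ e, Integrable ((S e).indicator fun _ => (1 : ℝ)) P := fun e =>
    (integrable_const 1).indicator (hX.measurableSet_step n e)
  have hZ : ∀ e, StronglyMeasurable[history X n] (Z e) := fun e =>
    stronglyMeasurable_hist X n fun h => G (e :: h)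
  have hZ1 : ∀ e, ∀ᵐ w ∂P, ‖Z e w‖ ≤ 1 := fun e => .of_forall fun w => by
    rw [Real.norm_of_nonneg (hG _).1]; exact (hG _).2
  have hZS : ∀ e, Integrable (Z e * (S e).indicator fun _ => (1 : ℝ)) P := fun e =>
    (hS e).bdd_mul ((hZ e).mono hm).aestronglyMeasurable (hZ1 e)
  have hce : ∀ e, P[Z e * (S e).indicator (fun _ => (1 : ℝ)) | history X n] =ᵐ[P]
      Z e * fun w => prob ω (X n w) (priorVisits (fun m => X m w) n) e := fun e =>
    (condExp_stronglyMeasurable_mul_of_bound hm (hZ e) (hS e) 1 (hZ1 e)).trans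
      ((Filter.EventuallyEq.refl _ _).mul (hX.step n e))
  have hleft : (fun w => ExcitedWalk.step (envRule ω) G (hist (fun m => X m w) n)) =ᵐ[P] fun w =>
      ∑ e, (P[Z e * (S e).indicator (fun _ => (1 : ℝ)) | history X n]) w := by
    filter_upwards [hX.start, hX.ae_exists_step, ae_all_iff.2 hce] with w h0 hstep hw
    simp only [hw, ExcitedWalk.step, envRule_hist (p := fun m => X m w) h0 hstep, Pi.mul_apply, Z,
      mul_comm]
  have hright : (fun w => G (hist (fun m => X m w) (n + 1))) =ᵐ[P] fun w =>
      ∑ e, (Z e * (S e).indicator fun _ => (1 : ℝ)) w := by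
    filter_upwards [hX.ae_exists_step] with w hstep
    obtain ⟨e, he⟩ := hstep n
    rw [Finset.sum_eq_single e]
    · rw [hist_succ he, Pi.mul_apply, Set.indicator_of_mem (s := S e) he, mul_one]
    · intro e' _ hne
      have : w ∉ S e' := fun hw => hne (vec_injective (add_left_cancel (hw.symm.trans he)))
      rw [Pi.mul_apply, Set.indicator_of_notMem this, mul_zero]
    · simp
  rw [integral_congr_ae hleft, integral_congr_ae hright, integral_finsetSum _ fun e _ =>
    integrable_condExp, integral_finsetSum _ fun e _ => hZS e]
  exact Finset.sum_congr rfl fun e _ => integral_condExp hm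

variable (hκ : 0 < κ)
include hκ

/-- The history of an excited random walk follows the rule of its environment. -/
theorem integral_hist {F : List (Dir d) → ℝ} (hF : ∀ h, F h ∈ Set.Icc (0 : ℝ) 1) (n : ℕ) :
    ∫ w, F (hist (fun m => X m w) n) ∂P = expect (envRule ω) n F [] := by
  have key : ∀ n m, ∫ w, expect (envRule ω) n F (hist (fun m => X m w) m) ∂P =
      ∫ w, F (hist (fun m => X m w) (m + n)) ∂P := by
    intro n
    induction n with
    | zero => intro m; rfl
    | succ n ih =>
      intro m
      have h1 := (hX.integral_step_hist
        (fun h => (admissible_envRule hκ ω).expect_mem_Icc hF n h) m).trans (ih (m + 1))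
      rw [show m + (n + 1) = m + 1 + n by ring]
      exact h1
  have := key n 0
  simp only [hist, zero_add] at this
  rw [← this, integral_const, probReal_univ, one_smul]

theorem measure_hist_mem (A : Set (List (Dir d))) (n : ℕ) :
    P {w | hist (fun m => X m w) n ∈ A} =
      ENNReal.ofReal (expect (envRule ω) n (A.indicator 1) []) := by
  have hA : MeasurableSet {w | hist (fun m => X m w) n ∈ A} := by
    have := ((stronglyMeasurable_hist X n (A.indicator 1)).mono (hX.history_le n)).measurable
      (measurableSet_singleton (1 : ℝ))
    convert! this using 1
    ext w
    by_cases hw : hist (fun m => X m w) n ∈ A <;> simp [hw]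
  have h1 : ∀ w, A.indicator (1 : List (Dir d) → ℝ) (hist (fun m => X m w) n) =
      {w | hist (fun m => X m w) n ∈ A}.indicator 1 w := fun w => rfl
  rw [← hX.integral_hist hκ (indicator_one_mem_Icc A)]
  simp only [h1]
  rw [integral_indicator_one hA, ofReal_measureReal]

/-- If late visits to `B` are improbable, then almost surely there are only finitely many visits. -/
theorem ae_eventually_notMem {B : Set (List (Dir d))}
    (hB : ⨅ m, ⨆ n, ENNReal.ofReal
      (expect (envRule ω) (m + n) ((lateHit B m).indicator 1) []) = 0) :
    ∀ᵐ w ∂P, ∀ᶠ n in Filter.atTop, hist (fun m => X m w) n ∉ B := by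
  rw [ae_iff]
  refine le_antisymm (le_trans (le_iInf fun m => ?_) hB.le) zero_le
  have hmono : Monotone fun n => {w | hist (fun m => X m w) (m + n) ∈ lateHit B m} :=
    monotone_nat_of_le_succ fun n w hw => mem_lateHit_cons _ hw
  have hsub : {w | ¬∀ᶠ n in Filter.atTop, hist (fun m => X m w) n ∉ B} ⊆
      ⋃ n, {w | hist (fun m => X m w) (m + n) ∈ lateHit B m} := by
    intro w hw
    obtain ⟨n, hmn, hn⟩ := (Filter.not_eventually.1 hw).forall_exists_of_atTop m
    refine Set.mem_iUnion.2 ⟨n, hist (fun m => X m w) n, hist_suffix (Nat.le_add_left n m), ?_,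
      not_not.1 hn⟩
    rwa [length_hist]
  refine (measure_mono hsub).trans ?_
  rw [hmono.measure_iUnion]
  exact iSup_mono fun n => (hX.measure_hist_mem hκ _ _).le

end IsERW

end ExcitedWalk

theorem theorem2 {d : ℕ} (hd : 2 ≤ d)
    (κ : ℝ) (hκ : 0 < κ) (hκ' : κ ≤ 1 / (2 * (d : ℝ)))
    (ℓ : Fin d → ℝ) (hℓ : ∑ j, |ℓ j| = 1)
    (μ : Measure (ExcitedWalk.Env d κ ℓ)) [IsProbabilityMeasure μ]
    (hiid : ExcitedWalk.IsIID μ)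
    (hδ : 0 < ∫⁻ ω, ExcitedWalk.totalDrift ω 0 ∂μ) :
    ∀ᵐ ω ∂μ, ∀ (Ω' : Type*) [MeasurableSpace Ω'] (P : Measure Ω') [IsProbabilityMeasure P]
      (X : ℕ → Ω' → ExcitedWalk.Site d), ExcitedWalk.IsERW ω 0 P X →
        ∀ᵐ w ∂P, Filter.Tendsto (fun n => ExcitedWalk.proj ℓ (X n w)) Filter.atTop Filter.atTop := by
  have : NeZero d := ⟨by omega⟩
  obtain ⟨s, hs⟩ := ExcitedWalk.exists_drift_meanRule_pos hκ (0, 1) hδ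
  have hae : ∀ᵐ ω ∂μ, ∀ a : ℕ, _ := ae_all_iff.2 fun a : ℕ =>
    ExcitedWalk.ae_iInf_iSup_expect_lateHit μ hκ hiid
      ((ExcitedWalk.admissible_meanRule hκ).hitInf_localRule_eq_zero hd hℓ hs a [])
  filter_upwards [hae] with ω hω Ω' _ P _ X hX
  filter_upwards [hX.start, hX.ae_exists_step,
    ae_all_iff.2 fun a : ℕ => hX.ae_eventually_notMem hκ (hω a)] with w h0 hstep hw
  refine Filter.tendsto_atTop.2 fun b => ?_
  obtain ⟨a, ha⟩ := exists_nat_ge b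
  filter_upwards [hw a] with n hn
  rw [not_lt, ExcitedWalk.level,
    ExcitedWalk.pos_hist (p := fun m => X m w) h0 hstep] at hn
  exact ha.trans hn
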